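/- A binary agenda consists of a finite set $K$ of alternatives, a finite set $I$ of voters, a complete and transitive preference relation $\unrhd_i$ on $K$ for each $i\in I$, and a finite rooted tree in which every nonterminal node $n$ has exactly two immediate successors $n',n''$, with sets of alternatives $\psi(n)\subseteq K$ attached to the nodes such that $\psi(\text{root})=K$, $\psi(n)=\psi(n')\cup\psi(n'')$ for every nonterminal $n$, and $\psi(n)$ is a single alternative for every terminal $n$. Assume that $|I|$ is odd and that every $\unrhd_i$ is a linear order ("No Indifference"), and fix a linear order of the voters. The induced game with perfect information $\Gamma_\Psi$ is played as follows: starting from the root, at each nonterminal node that is reached all voters vote one after the other, in the fixed order and observing all earlier votes, for one of its two immediate successors; the successor with more votes is reached next; the outcome is the alternative attached to the terminal node that is reached. Voter $i$ ranks outcomes by $\unrhd_i$. A standard strategy of $i$ selects an available action at each nonterminal history at which $i$ moves. A strategy is a class of behaviorally equivalent standard strategies, i.e. standard strategies that allow the same nonterminal histories and choose the same actions at the allowed histories of $i$. Let $S=\prod_i S_i$ be the set of strategy profiles, $\zeta(s)\in K$ the outcome of $s\in S$, and, for a nonterminal history $h$, let $S_i(h)$ and $S_{-i}(h)$ be the projections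 of the set of profiles that reach $h$. For $R=\prod_j R_j\subseteq S$ put $R_i(h)=R_i\cap S_i(h)$ and $R_{-i}(h)=R_{-i}\cap S_{-i}(h)$. A strategy $s_i\in P_i$ is admissible with respect to $P_i\times Q_{-i}$ if no strategy in $P_i$ weakly dominates it against $Q_{-i}$, and it is B-dominated with respect to $P_i\times P_{-i}$ if it is not admissible with respect to $P_i\times Q_{-i}$, for every nonempty product subset $Q_{-i}\subseteq P_{-i}$. Let $\mathbb U_i(R)$ be the set of those $s_i\in R_i$ such that, for every history $h$ at which $i$ moves with $s_i\in S_i(h)$, if $R_i(h)\times R_{-i}(h)\neq\emptyset$ then $s_i$ is not B-dominated with respect to $R_i(h)\times R_{-i}(h)$. Let $\mathbb U(R)=\prod_i\mathbb U_i(R)$. Iterative Conditional B-Dominance (ICBD) yields $\mathbb U^\infty(S)=\bigcap_{n\ge 0}\mathbb U^n(S)$. Then $\Gamma_\Psi$ has a unique backward induction outcome $z^{BI}\in K$, i.e. $z^{BI}$ is the unique alternative that is the outcome of a (pure) subgame perfect equilibrium of $\Gamma_\Psi$, and $$\zeta\big(\mathbb U^\infty(S)\big)=\{z^{BI}\}.$$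 -/

import Mathlib

/-! ### Finite extensive-form games with perfect information and ordinal preferences -/

/-- A finite dynamic game with perfect information, players `I`, actions in `A`, outcomes in `Z`.
Histories are finite sequences of actions. At every nonterminal history exactly one player
(`mover`) is active, and she has at least two available actions. Information sets are
singletons and are identified with nonterminal histories. A terminal history `x` yields the
outcome `result x`; `pref i z z'` means that player `i` weakly prefers `z` to `z'`. -/
structure PIGame (I A Z : Type*) where
  hist : Set (List A)
  hist_finite : hist.Finite
  nil_mem : [] ∈ hist
  of_append_mem : ∀ (x : List A) (a : A), x ++ [a] ∈ hist → x ∈ hist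
  two_actions : ∀ (x : List A) (a : A), x ++ [a] ∈ hist → ∃ b, b ≠ a ∧ x ++ [b] ∈ hist
  mover : List A → I
  result : List A → Z
  pref : I → Z → Z → Prop
  pref_total : ∀ i z z', pref i z z' ∨ pref i z' z
  pref_trans : ∀ i z z' z'', pref i z z' → pref i z' z'' → pref i z z''

namespace PIGame

variable {I A Z : Type*} (G : PIGame I A Z)

/-- Strict preference, the asymmetric part of `pref`. -/
def strictPref (i : I) (z z' : Z) : Prop := G.pref i z z' ∧ ¬ G.pref i z' z

/-- Actions available at a history. -/
def avail (x : List A) : Set A := {a | x ++ [a] ∈ G.hist}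

/-- Nonterminal histories, i.e. the information sets of all the players. -/
def Nonterminal (x : List A) : Prop := x ∈ G.hist ∧ (G.avail x).Nonempty

/-- The information sets of player `i`. -/
def InfoSet (i : I) : Type _ := {x : List A // G.Nonterminal x ∧ G.mover x = i}

/-- Standard strategies of player `i`: an available action at each of her information sets. -/
def StdStrategy (i : I) : Type _ := (h : G.InfoSet i) → {a : A // a ∈ G.avail h.1}

open Classical in
/-- One step of play; terminal histories are fixed. -/
noncomputable def next (σ : ∀ i, G.StdStrategy i) (x : List A) : List A :=
  if h : G.Nonterminal x then x ++ [(σ (G.mover x) ⟨x, h, rfl⟩).1] else x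

/-- The terminal history reached from the history `x` when `σ` is followed from `x` on.
(Every play is over after at most as many steps as there are histories.) -/
noncomputable def playFrom (σ : ∀ i, G.StdStrategy i) (x : List A) : List A :=
  (G.next σ)^[G.hist.ncard] x

/-- The terminal history induced by a profile of standard strategies. -/
noncomputable def play (σ : ∀ i, G.StdStrategy i) : List A := G.playFrom σ []

/-! #### Subgame perfect equilibrium -/

open Classical in
/-- Subgame perfect equilibrium (in pure standard strategies): no player can gain by a
unilateral deviation in the subgame that starts at any history. -/
def IsSubgamePerfect (σ : ∀ i, G.StdStrategy i) : Prop :=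
  ∀ x ∈ G.hist, ∀ (i : I) (τ : G.StdStrategy i),
    G.pref i (G.result (G.playFrom σ x)) (G.result (G.playFrom (Function.update σ i τ) x))

/-- The backward induction outcomes: the outcomes of the subgame perfect equilibria. -/
def backwardInductionOutcomes : Set Z :=
  {z | ∃ σ : ∀ i, G.StdStrategy i, G.IsSubgamePerfect σ ∧ G.result (G.play σ) = z}

/-! #### Strategies, i.e. classes of behaviorally equivalent standard strategies -/

/-- The standard strategy `s` of player `i` allows the history `x`. -/
def Allows {i : I} (s : G.StdStrategy i) (x : List A) : Prop :=
  ∃ σ : ∀ j, G.StdStrategy j, σ i = s ∧ x <+: G.play σ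

/-- Behavioral equivalence: the same information sets (of all the players) are allowed, and the
same actions are chosen at the allowed information sets of player `i`. -/
def behavioralSetoid (i : I) : Setoid (G.StdStrategy i) where
  r s s' := (∀ x, G.Nonterminal x → (G.Allows s x ↔ G.Allows s' x)) ∧
    ∀ h : G.InfoSet i, G.Allows s h.1 → s h = s' h
  iseqv :=
    { refl := fun _ => ⟨fun _ _ => Iff.rfl, fun _ _ => rfl⟩
      symm := fun {_ _} e => ⟨fun x hx => (e.1 x hx).symm,
        fun h hs => (e.2 h ((e.1 h.1 h.2.1).2 hs)).symm⟩
      trans := fun {_ _ _} e e' => ⟨fun x hx => (e.1 x hx).trans (e'.1 x hx),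
        fun h hs => (e.2 h hs).trans (e'.2 h ((e.1 h.1 h.2.1).1 hs))⟩ }

/-- (Reduced) strategies of player `i`. -/
def Strategy (i : I) : Type _ := Quotient (G.behavioralSetoid i)

/-- The terminal history induced by a profile of strategies. It does not depend on the
representatives (`path_mk`). -/
noncomputable def path (s : ∀ i, G.Strategy i) : List A := G.play fun i => (s i).out

/-- The outcome function on profiles of strategies. -/
noncomputable def outcome (s : ∀ i, G.Strategy i) : Z := G.result (G.path s)

/-- Profiles of strategies of the opponents of player `i`. -/
def Opp (i : I) : Type _ := (j : {j : I // j ≠ i}) → G.Strategy j.1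

open Classical in
/-- The profile in which player `i` uses `s` and her opponents use `t`. -/
noncomputable def join {i : I} (s : G.Strategy i) (t : G.Opp i) : ∀ j, G.Strategy j :=
  fun j => if h : j = i then cast (congrArg G.Strategy h.symm) s else t ⟨j, h⟩

/-- The profiles of strategies that reach the history `x`. -/
def reach (x : List A) : Set (∀ i, G.Strategy i) := {s | x <+: G.path s}

/-- The projection of `reach x` on the strategies of player `i`. -/
def reachOwn (i : I) (x : List A) : Set (G.Strategy i) := (fun s => s i) '' G.reach x

/-- The projection of `reach x` on the profiles of strategies of the opponents of player `i`. -/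
def reachOpp (i : I) (x : List A) : Set (G.Opp i) := (fun s j => s j.1) '' G.reach x

/-! #### Dominance and Iterative Conditional B-Dominance

A restriction is a family `R` of sets of strategies, standing for the product of the `R i`. -/

/-- The strategy `t` weakly dominates `s` against the set `Q` of profiles of the opponents. -/
def WeaklyDominates {i : I} (t s : G.Strategy i) (Q : Set (G.Opp i)) : Prop :=
  (∀ q ∈ Q, G.pref i (G.outcome (G.join t q)) (G.outcome (G.join s q))) ∧
    ∃ q ∈ Q, G.strictPref i (G.outcome (G.join t q)) (G.outcome (G.join s q))

/-- The strategies of player `i` that are admissible with respect to `P × Q`. -/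
def admissible {i : I} (P : Set (G.Strategy i)) (Q : Set (G.Opp i)) : Set (G.Strategy i) :=
  {s ∈ P | ¬ ∃ t ∈ P, G.WeaklyDominates t s Q}

/-- The strategies of player `i` that are Börgers dominated with respect to `P × Q`: those not
admissible with respect to `P × Q'`, for every nonempty product subset `Q'` of `Q`. -/
def bDominated {i : I} (P : Set (G.Strategy i)) (Q : Set (G.Opp i)) : Set (G.Strategy i) :=
  {s ∈ P | ∀ B : (j : {j : I // j ≠ i}) → Set (G.Strategy j.1),
    (Set.univ.pi B).Nonempty → Set.univ.pi B ⊆ Q → s ∉ G.admissible P (Set.univ.pi B)}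

/-- `R_i(x)`. -/
def ownAt (R : ∀ j, Set (G.Strategy j)) (i : I) (x : List A) : Set (G.Strategy i) :=
  R i ∩ G.reachOwn i x

/-- `R_{-i}(x)`. -/
def oppAt (R : ∀ j, Set (G.Strategy j)) (i : I) (x : List A) : Set (G.Opp i) :=
  {t | ∀ j, t j ∈ R j.1} ∩ G.reachOpp i x

/-- The strategies in `R` that are not conditionally B-dominated with respect to `R`. -/
def undominated (R : ∀ j, Set (G.Strategy j)) (i : I) : Set (G.Strategy i) :=
  {s ∈ R i | ∀ h : G.InfoSet i, s ∈ G.reachOwn i h.1 →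
    (G.ownAt R i h.1).Nonempty → (G.oppAt R i h.1).Nonempty →
      s ∉ G.bDominated (G.ownAt R i h.1) (G.oppAt R i h.1)}

/-- The restriction that survives `n` rounds, starting from all strategies. -/
def icbdRound (n : ℕ) : ∀ i, Set (G.Strategy i) := G.undominated^[n] fun _ => Set.univ

/-- The strategy profiles that survive Iterative Conditional B-Dominance. -/
def icbd : Set (∀ i, G.Strategy i) := ⋂ n : ℕ, Set.univ.pi (G.icbdRound n)

/-! #### The definitions above make sense -/

theorem next_mem (σ : ∀ i, G.StdStrategy i) {x : List A} (hx : x ∈ G.hist) :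
    G.next σ x ∈ G.hist := by
  unfold next
  split_ifs with h
  · exact (σ (G.mover x) ⟨x, h, rfl⟩).2
  · exact hx

theorem prefix_mem {x y : List A} (hxy : x <+: y) (hy : y ∈ G.hist) : x ∈ G.hist := by
  obtain ⟨l, rfl⟩ := hxy
  induction l using List.reverseRecOn with
  | nil => simpa using hy
  | append_singleton l a ih =>
    rw [← List.append_assoc] at hy
    exact ih (G.of_append_mem _ _ hy)

theorem length_lt {x : List A} (hx : x ∈ G.hist) : x.length < G.hist.ncard := by
  have h1 : (fun k => x.take k) '' (Set.Iic x.length) ⊆ G.hist := by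
    rintro _ ⟨k, -, rfl⟩
    exact G.prefix_mem (List.take_prefix k x) hx
  have h2 : Set.InjOn (fun k => x.take k) (Set.Iic x.length) := by
    intro a ha b hb hab
    have := congrArg List.length hab
    simp only [List.length_take] at this
    simp only [Set.mem_Iic] at ha hb
    omega
  have h3 := Set.ncard_le_ncard h1 G.hist_finite
  rw [h2.ncard_image] at h3
  simp at h3
  omega

/-- The history at which a play stops is terminal. -/
theorem playFrom_terminal (σ : ∀ i, G.StdStrategy i) {x : List A} (hx : x ∈ G.hist) :
    G.playFrom σ x ∈ G.hist ∧ ¬ G.Nonterminal (G.playFrom σ x) := by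
  have key : ∀ n, (G.next σ)^[n] x ∈ G.hist ∧
      (G.Nonterminal ((G.next σ)^[n] x) → n ≤ ((G.next σ)^[n] x).length) := by
    intro n
    induction n with
    | zero => exact ⟨hx, fun _ => Nat.zero_le _⟩
    | succ n ih =>
      rw [Function.iterate_succ_apply']
      refine ⟨G.next_mem σ ih.1, fun h => ?_⟩
      by_cases hn : G.Nonterminal ((G.next σ)^[n] x)
      · have := ih.2 hn
        rw [next, dif_pos hn]
        simpa using this
      · rw [next, dif_neg hn] at h
        exact absurd h hn
  refine ⟨(key _).1, fun h => ?_⟩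
  have h1 := (key _).2 h
  have h2 := G.length_lt (key G.hist.ncard).1
  omega

theorem prefix_next (σ : ∀ i, G.StdStrategy i) (x : List A) : x <+: G.next σ x := by
  unfold next
  split_ifs
  · exact List.prefix_append _ _
  · exact List.prefix_rfl

theorem prefix_iterate (σ : ∀ i, G.StdStrategy i) (n : ℕ) (x : List A) :
    x <+: (G.next σ)^[n] x := by
  induction n generalizing x with
  | zero => exact List.prefix_rfl
  | succ n ih => exact (G.prefix_next σ x).trans (ih _)

/-- The path of play does not depend on the representatives of the strategies. -/
theorem path_mk (σ : ∀ i, G.StdStrategy i) :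
    G.path (fun i => Quotient.mk (G.behavioralSetoid i) (σ i)) = G.play σ := by
  set τ : ∀ i, G.StdStrategy i :=
    fun i => (Quotient.mk (G.behavioralSetoid i) (σ i)).out with hτ
  have hr : ∀ i, (G.behavioralSetoid i).r (τ i) (σ i) := fun i =>
    Quotient.exact (Quotient.out_eq (Quotient.mk (G.behavioralSetoid i) (σ i)))
  have key : ∀ n, n ≤ G.hist.ncard → (G.next τ)^[n] [] = (G.next σ)^[n] [] := by
    intro n
    induction n with
    | zero => intro _; rfl
    | succ n ih =>
      intro hn
      have ih := ih (by omega)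
      rw [Function.iterate_succ_apply', Function.iterate_succ_apply', ← ih]
      have hpre : (G.next τ)^[n] [] <+: G.play τ := by
        obtain ⟨m, hm⟩ := Nat.exists_eq_add_of_le (show n ≤ G.hist.ncard by omega)
        unfold play playFrom
        rw [hm, Nat.add_comm, Function.iterate_add_apply]
        exact G.prefix_iterate τ m _
      unfold next
      split_ifs with h
      · have := (hr (G.mover _)).2 ⟨_, h, rfl⟩ ⟨τ, rfl, hpre⟩
        rw [this]
      · rfl
  exact key _ le_rfl

end PIGame

/-! ### Binary agendas with sequential majority voting -/

/-- Finite rooted arborescences in which every nonterminal node has exactly two immediate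
successors and every terminal node carries an alternative. -/
inductive AgendaTree (K : Type*) where
  | leaf (k : K) : AgendaTree K
  | node (l r : AgendaTree K) : AgendaTree K

namespace AgendaTree

variable {K : Type*}

/-- The set of alternatives attached to the root of a subtree: a single alternative at a terminal
node, the union of the sets attached to the two immediate successors otherwise. -/
def alternatives : AgendaTree K → Set K
  | leaf k => {k}
  | node l r => l.alternatives ∪ r.alternatives

/-- The majority rule: a ballot is `true` for the first successor and `false` for the second. -/
def FirstWins (ballots : List Bool) : Prop := ballots.count false < ballots.count true

open Classical in
/-- The possible sequences of ballots when `N` voters vote one after the other at every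
nonterminal node that is reached, and the successor with more votes is reached next. -/
def IsHistory (N : ℕ) : AgendaTree K → List Bool → Prop
  | leaf _, x => x = []
  | node l r, x => x.length < N ∨ (N ≤ x.length ∧
      if FirstWins (x.take N) then l.IsHistory N (x.drop N) else r.IsHistory N (x.drop N))

open Classical in
/-- The alternative selected by a terminal sequence of ballots. -/
noncomputable def selected (N : ℕ) : AgendaTree K → List Bool → K
  | leaf k, _ => k
  | node l r, x =>
      if FirstWins (x.take N) then l.selected N (x.drop N) else r.selected N (x.drop N)

/-- The height of the tree. -/
def height : AgendaTree K → ℕ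
  | leaf _ => 0
  | node l r => max l.height r.height + 1

theorem isHistory_nil (N : ℕ) (t : AgendaTree K) : t.IsHistory N [] := by
  induction t with
  | leaf k => rfl
  | node l r hl hr =>
    simp only [IsHistory, List.length_nil, List.take_nil, List.drop_nil]
    rcases Nat.eq_zero_or_pos N with h | h
    · right
      refine ⟨by omega, ?_⟩
      split_ifs <;> assumption
    · exact Or.inl h

theorem isHistory_of_append (N : ℕ) (t : AgendaTree K) (x : List Bool) (a : Bool)
    (h : t.IsHistory N (x ++ [a])) : t.IsHistory N x := by
  induction t generalizing x with
  | leaf k => simp [IsHistory] at h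
  | node l r hl hr =>
    simp only [IsHistory] at h ⊢
    by_cases hx : x.length < N
    · exact Or.inl hx
    · right
      rw [not_lt] at hx
      refine ⟨hx, ?_⟩
      rcases h with h | ⟨-, h⟩
      · simp at h; omega
      · rw [List.take_append_of_le_length hx, List.drop_append_of_le_length hx] at h
        split_ifs at h ⊢
        · exact hl _ h
        · exact hr _ h

theorem isHistory_append (N : ℕ) (t : AgendaTree K) (x : List Bool) (a b : Bool)
    (h : t.IsHistory N (x ++ [a])) : t.IsHistory N (x ++ [b]) := by
  induction t generalizing x with
  | leaf k => simp [IsHistory] at h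
  | node l r hl hr =>
    simp only [IsHistory] at h ⊢
    by_cases hx : x.length < N
    · rcases Nat.lt_or_ge (x.length + 1) N with h1 | h1
      · exact Or.inl (by simpa using h1)
      · right
        have e : (x ++ [b]).drop N = [] := List.drop_eq_nil_of_le (by simp; omega)
        refine ⟨by simpa using h1, ?_⟩
        rw [e]
        split_ifs
        · exact isHistory_nil N l
        · exact isHistory_nil N r
    · right
      rw [not_lt] at hx
      rcases h with h | ⟨-, h⟩
      · simp at h; omega
      · rw [List.take_append_of_le_length hx, List.drop_append_of_le_length hx] at h ⊢
        refine ⟨by simp; omega, ?_⟩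
        split_ifs at h ⊢
        · exact hl _ h
        · exact hr _ h

theorem length_le_of_isHistory (N : ℕ) (t : AgendaTree K) (x : List Bool)
    (h : t.IsHistory N x) : x.length ≤ N * t.height := by
  induction t generalizing x with
  | leaf k => simp only [IsHistory] at h; simp [h]
  | node l r hl hr =>
    have e1 : N * l.height ≤ N * max l.height r.height := Nat.mul_le_mul_left _ (le_max_left _ _)
    have e2 : N * r.height ≤ N * max l.height r.height := Nat.mul_le_mul_left _ (le_max_right _ _)
    simp only [IsHistory] at h
    simp only [height, Nat.mul_add, Nat.mul_one]
    rcases h with h | ⟨h0, h⟩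
    · omega
    · split_ifs at h
      · have := hl _ h; simp at this; omega
      · have := hr _ h; simp at this; omega

end AgendaTree

/-- A binary agenda on the set `K` of alternatives for the set `I` of individuals, whose rational
preferences are `pref` (`pref i k k'`: individual `i` weakly prefers `k` to `k'`). All the
alternatives are attached to the root. -/
structure BinaryAgenda (K I : Type*) where
  pref : I → K → K → Prop
  pref_total : ∀ i k k', pref i k k' ∨ pref i k' k
  pref_trans : ∀ i k k' k'', pref i k k' → pref i k' k'' → pref i k k''
  tree : AgendaTree K
  alternatives_root : tree.alternatives = Set.univ

namespace BinaryAgenda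

variable {K I : Type*}

/-- The "No Indifference" condition: all the preferences are linear orders. -/
def NoIndifference (Ψ : BinaryAgenda K I) : Prop :=
  ∀ i k k', Ψ.pref i k k' → Ψ.pref i k' k → k = k'

/-- The dynamic game with perfect information induced by a binary agenda with sequential majority
voting: at every nonterminal node of the agenda that is reached all the individuals cast a ballot
for one of its two immediate successors, one after the other in the order `first to last` given by
`order`, observing all the previous ballots. -/
noncomputable def votingGame [Fintype I] [Nonempty I] (Ψ : BinaryAgenda K I)
    (order : Fin (Fintype.card I) ≃ I) : PIGame I Bool K where
  hist := {x | Ψ.tree.IsHistory (Fintype.card I) x}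
  hist_finite := (List.finite_length_le Bool (Fintype.card I * Ψ.tree.height)).subset
    fun x hx => Ψ.tree.length_le_of_isHistory _ x hx
  nil_mem := Ψ.tree.isHistory_nil _
  of_append_mem := Ψ.tree.isHistory_of_append _
  two_actions := fun x a h => ⟨!a, by simp, Ψ.tree.isHistory_append _ x a (!a) h⟩
  mover := fun x => order ⟨x.length % Fintype.card I, Nat.mod_lt _ Fintype.card_pos⟩
  result := Ψ.tree.selected (Fintype.card I)
  pref := Ψ.pref
  pref_total := Ψ.pref_total
  pref_trans := Ψ.pref_trans

end BinaryAgenda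

/-! The argument applies to finite perfect-information games with two actions at every nonterminal
history and no indifference, unfolded into binary trees. The elimination operator lies between two
conditions on plans. A plan that is a best reply to some surviving opponents' profile at each of its
own nodes that it allows and that these opponents reach (`Justified`) is kept: a best reply to one
profile is admissible against that singleton. A plan that a surviving one beats against all
surviving opponents reaching a node is B-dominated there, so a fixed point contains only
`Undominated` plans.

Uniqueness of the outcome (`play_eq_of_undominated`): if the outcome is constant within each
immediate subtree, the root player cannot retain two choices with different outcomes, since the
worse one would be strictly dominated.

It remains to find a surviving profile with the backward induction outcome. A node is judged only
against opponents who reach it, so a subtree is played knowing that an earlier mover gave up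
something to enter. The induction therefore carries outside options and the class `robust` of plans
that respect them, and it proves `KeepsValue` and `ConvergesToValue` together. Let `d` be the root
player's best choice and `e` its value. Robust plans of `ch d` extend to the whole tree if the
opponents have justified plans in the other subtree that hold the root player to at most `e`; this
is `Deters`. Otherwise the root player can earn more than `e` there against all justified opponents.
Continuing the chain of restrictions until it stops then yields an equilibrium with a single
surviving outcome better than `e`. By `ConvergesToValue` this outcome is the subtree's value, which
is no better than `e`: a contradiction. Conversely, `ConvergesToValue` passes to a node because a
better value in the subtree not chosen would survive by `KeepsValue`, against uniqueness of the
surviving outcome. -/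

/-! ### Binary game trees -/

/-- Finite binary game trees with perfect information: players `I`, outcomes `Z`. -/
inductive GameTree (I Z : Type*) where
  | leaf (z : Z) : GameTree I Z
  | node (a : I) (ch : Bool → GameTree I Z) : GameTree I Z

/-- Ordinal preferences without indifference. -/
structure LinearPref {I Z : Type*} (P : I → Z → Z → Prop) : Prop where
  total : ∀ i z z', P i z z' ∨ P i z' z
  trans : ∀ i z z' z'', P i z z' → P i z' z'' → P i z z''
  antisymm : ∀ i z z', P i z z' → P i z' z → z = z'

theorem LinearPref.refl {I Z : Type*} {P : I → Z → Z → Prop} (hP : LinearPref P) (i : I) (z : Z) :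
    P i z z := (hP.total i z z).elim id id

namespace GameTree

variable {I Z : Type*}

/-- Plans of action: one action at every nonterminal node. The plan of a player is only consulted
at the nodes where she moves. -/
def Strat : GameTree I Z → Type
  | leaf _ => Unit
  | node _ ch => Bool × ((b : Bool) → Strat (ch b))

instance finite_strat : (t : GameTree I Z) → Finite t.Strat
  | leaf _ => inferInstanceAs (Finite Unit)
  | node _ ch =>
    have : ∀ b, Finite (ch b).Strat := fun b => finite_strat (ch b)
    inferInstanceAs (Finite (Bool × ((b : Bool) → (ch b).Strat)))

instance nonempty_strat : (t : GameTree I Z) → Nonempty t.Strat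
  | leaf _ => ⟨()⟩
  | node _ ch => ⟨(true, fun b => Classical.choice (nonempty_strat (ch b)))⟩

/-- The outcome of a profile. -/
def play : (t : GameTree I Z) → (I → t.Strat) → Z
  | leaf z, _ => z
  | node a ch, σ => play (ch (σ a).1) fun i => (σ i).2 (σ a).1

theorem play_node {a : I} {ch : Bool → GameTree I Z} (σ : I → (node a ch).Strat) {d : Bool}
    (h : (σ a).1 = d) : play (node a ch) σ = play (ch d) fun i => (σ i).2 d := by
  subst h; rfl

/-- Glues plans of the two subtrees. The case split on `d` avoids casts between the types of
continuation plans. -/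
theorem exists_strat {a : I} {ch : Bool → GameTree I Z} (d₀ d : Bool) (s : (ch d).Strat)
    (s' : (ch (!d)).Strat) : ∃ r : (node a ch).Strat, r.1 = d₀ ∧ r.2 d = s ∧ r.2 (!d) = s' := by
  cases d
  · exact ⟨(d₀, fun | false => s | true => s'), rfl, rfl, rfl⟩
  · exact ⟨(d₀, fun | true => s | false => s'), rfl, rfl, rfl⟩

/-- The sets of strategies induced on an immediate subtree. -/
def restrict {a : I} {ch : Bool → GameTree I Z} (R : I → Set (node a ch).Strat) (b : Bool) :
    I → Set (ch b).Strat :=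
  fun i => {s | ∃ r ∈ R i, (i = a → r.1 = b) ∧ r.2 b = s}

theorem restrict_mono {a : I} {ch : Bool → GameTree I Z} {R R' : I → Set (node a ch).Strat}
    (h : R ≤ R') (b : Bool) : restrict R b ≤ restrict R' b :=
  fun i _ ⟨r, hr, e⟩ => ⟨r, h i hr, e⟩

theorem antitone_restrict {a : I} {ch : Bool → GameTree I Z} {R : ℕ → I → Set (node a ch).Strat}
    (h : Antitone R) (b : Bool) : Antitone fun k => restrict (R k) b :=
  fun _ _ hkl => restrict_mono (h hkl) b

/-! ### Backward induction value, justification and robustness -/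

section Preferences

variable (P : I → Z → Z → Prop)

open Classical in
/-- The backward induction value. -/
noncomputable def value : GameTree I Z → Z
  | leaf z => z
  | node a ch => if P a (value (ch true)) (value (ch false)) then value (ch true)
      else value (ch false)

/-- Player `j` has no profitable deviation from `σ`. -/
def NoGain (t : GameTree I Z) (j : I) (σ : I → t.Strat) : Prop :=
  ∀ σ' : I → t.Strat, (∀ i, i ≠ j → σ' i = σ i) → P j (t.play σ) (t.play σ')

/-- At every node of `j` that is allowed by `s` and by some opponents' strategies in `R`, the
strategy `s` is a best reply to some profile of opponents' strategies in `R` reaching it. -/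
def Justified : (t : GameTree I Z) → (I → Set t.Strat) → I → t.Strat → Prop
  | leaf _, _, _, _ => True
  | node a ch, R, j, s =>
    (j = a → (∀ i, i ≠ j → (R i).Nonempty) →
      ∃ σ : I → (node a ch).Strat, σ j = s ∧ (∀ i, i ≠ j → σ i ∈ R i) ∧ NoGain P (node a ch) j σ) ∧
    ∀ b, (j = a → s.1 = b) → Justified (ch b) (restrict R b) j (s.2 b)

/-- At every node of `j` that is allowed by `s` and reached by `R`, no strategy in `R` is strictly
better than `s` against all the opponents' strategies in `R` reaching it. -/
def Undominated : (t : GameTree I Z) → (I → Set t.Strat) → I → t.Strat → Prop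
  | leaf _, _, _, _ => True
  | node a ch, R, j, s =>
    (j = a → (∀ i, i ≠ j → (R i).Nonempty) → ∀ s' ∈ R j,
      ∃ σ σ' : I → (node a ch).Strat, σ j = s ∧ σ' j = s' ∧ (∀ i, i ≠ j → σ i ∈ R i) ∧
        (∀ i, i ≠ j → σ' i = σ i) ∧ P j (play _ σ) (play _ σ')) ∧
    ∀ b, (j = a → s.1 = b) → Undominated (ch b) (restrict R b) j (s.2 b)

/-- The strategies justified with respect to the first `n` members of the chain `R` which, for a
player `j` with an outside option `c j`, are moreover best replies attaining at least the outside
option against opponents' strategies of the same kind one level below. -/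
def robust {t : GameTree I Z} (R : ℕ → I → Set t.Strat) (c : I → Option Z) :
    ℕ → I → Set t.Strat
  | 0 => fun _ => Set.univ
  | m + 1 => fun j => {s | (∀ k ≤ m, Justified P t (R k) j s) ∧
      ∀ e, c j = some e → ∃ σ : I → t.Strat, σ j = s ∧ (∀ i, i ≠ j → σ i ∈ robust R c m i) ∧
        NoGain P t j σ ∧ P j (t.play σ) e}

variable {P}

theorem robust_justified {t : GameTree I Z} {R : ℕ → I → Set t.Strat} {c : I → Option Z} {n : ℕ}
    {j : I} {s : t.Strat} (h : s ∈ robust P R c n j) : ∀ k < n, Justified P t (R k) j s := by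
  cases n with
  | zero => intro k hk; omega
  | succ m => exact fun k hk => h.1 k (by omega)

/-- Without an outside option the recursive clause is void, so only justification matters. -/
theorem mem_robust_of_none {t : GameTree I Z} {R : ℕ → I → Set t.Strat} {c : I → Option Z} {n : ℕ}
    {j : I} {s : t.Strat} (hj : c j = none) (h : ∀ k < n, Justified P t (R k) j s) :
    s ∈ robust P R c n j := by
  cases n with
  | zero => trivial
  | succ m => exact ⟨fun k hk => h k (by omega), fun e he => by simp [hj] at he⟩

/-! ### Values and deviations at a single node -/

theorem value_node (hP : LinearPref P) (a : I) (ch : Bool → GameTree I Z) :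
    ∃ d, value P (node a ch) = value P (ch d) ∧
      P a (value P (ch d)) (value P (ch (!d))) := by
  by_cases h : P a (value P (ch true)) (value P (ch false))
  · exact ⟨true, by simp [value, h], h⟩
  · exact ⟨false, by simp [value, h], (hP.total _ _ _).resolve_left h⟩

theorem pref_value_node (hP : LinearPref P) (a : I) (ch : Bool → GameTree I Z) (b : Bool) :
    P a (value P (node a ch)) (value P (ch b)) := by
  obtain ⟨d, h1, h2⟩ := value_node hP a ch
  rw [h1]
  rcases Bool.eq_or_eq_not b d with rfl | rfl
  · exact hP.refl _ _
  · exact h2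

/-- Deviations of a player who does not move at the root. -/
theorem noGain_node_of_ne {a : I} {ch : Bool → GameTree I Z} {j : I} (hj : j ≠ a)
    {σ : I → (node a ch).Strat} {d : Bool} (hd : (σ a).1 = d)
    (h : NoGain P (ch d) j fun i => (σ i).2 d) : NoGain P (node a ch) j σ := by
  intro σ' hσ'
  rw [play_node σ hd, play_node σ' (d := d) (by rw [hσ' a hj.symm, hd])]
  exact h _ fun i hi => by rw [hσ' i hi]

/-- Deviations of the player who moves at the root. -/
theorem noGain_node_self (hP : LinearPref P) {a : I} {ch : Bool → GameTree I Z}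
    {σ : I → (node a ch).Strat} {d : Bool} (hd : (σ a).1 = d)
    (h : NoGain P (ch d) a fun i => (σ i).2 d) {e : Z} (he : P a (play (ch d) fun i => (σ i).2 d) e)
    (h' : ∀ b, b ≠ d → ∀ τ : I → (ch b).Strat, (∀ i, i ≠ a → τ i = (σ i).2 b) →
      P a e (play _ τ)) :
    NoGain P (node a ch) a σ := by
  intro σ' hσ'
  rw [play_node σ hd]
  by_cases h1 : (σ' a).1 = d
  · rw [play_node σ' h1]
    exact h _ fun i hi => by rw [hσ' i hi]
  · exact hP.trans _ _ _ _ he (h' _ h1 _ fun i hi => by rw [hσ' i hi])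

theorem NoGain.sub {a : I} {ch : Bool → GameTree I Z} {j : I}
    {σ : I → (node a ch).Strat} {d : Bool} (hd : (σ a).1 = d)
    (h : NoGain P (node a ch) j σ) : NoGain P (ch d) j fun i => (σ i).2 d := by
  classical
  intro τ hτ
  obtain ⟨r, h1, h2, -⟩ := exists_strat (a := a) (ch := ch) d d (τ j) ((σ j).2 (!d))
  have h3 := h (Function.update σ j r) fun i hi => by simp [hi]
  rw [play_node σ hd, play_node (Function.update σ j r) (d := d)] at h3
  · convert h3 using 2
    funext i
    by_cases hi : i = j
    · subst hi; simp [h2]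
    · simp [hi, hτ i hi]
  · by_cases hi : a = j
    · subst hi; simp [h1]
    · simp [hi, hd]

/-- A deviation of the root player to the other subtree. -/
theorem NoGain.other {a : I} {ch : Bool → GameTree I Z}
    {σ : I → (node a ch).Strat} (h : NoGain P (node a ch) a σ) (d : Bool)
    (τ : I → (ch d).Strat) (hτ : ∀ i, i ≠ a → τ i = (σ i).2 d) :
    P a (play _ σ) (play _ τ) := by
  classical
  obtain ⟨r, h1, h2, -⟩ := exists_strat (a := a) (ch := ch) d d (τ a) ((σ a).2 (!d))
  have h3 := h (Function.update σ a r) fun i hi => by simp [hi]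
  rw [play_node (Function.update σ a r) (d := d) (by simp [h1])] at h3
  convert h3 using 2
  funext i
  by_cases hi : i = a
  · subst hi; simp [h2]
  · simp [hi, hτ i hi]

/-! #### Constancy of outcomes -/

theorem Justified.undominated {t : GameTree I Z} {R : I → Set t.Strat} {j : I} {s : t.Strat}
    (h : Justified P t R j s) : Undominated P t R j s := by
  classical
  induction t with
  | leaf => trivial
  | node a ch ih =>
    refine ⟨fun ha hne s' _ => ?_, fun b hb => ih b (h.2 b hb)⟩
    obtain ⟨σ, h1, h2, h3⟩ := h.1 ha hne
    have h4 : ∀ i, i ≠ j → Function.update σ j s' i = σ i := fun i hi => by simp [hi]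
    exact ⟨σ, Function.update σ j s', h1, by simp, h2, h4, h3 _ h4⟩

theorem play_eq_of_undominated (hP : LinearPref P) {t : GameTree I Z} {R : I → Set t.Strat}
    (h : ∀ j, ∀ s ∈ R j, Undominated P t R j s) {σ τ : I → t.Strat} (hσ : ∀ j, σ j ∈ R j)
    (hτ : ∀ j, τ j ∈ R j) : t.play σ = t.play τ := by
  induction t with
  | leaf => rfl
  | node a ch ih =>
    have key : ∀ b, ∀ σ τ : I → (node a ch).Strat, (∀ j, σ j ∈ R j) → (∀ j, τ j ∈ R j) →
        (σ a).1 = b → (τ a).1 = b → play _ σ = play _ τ := by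
      intro b σ τ hσ hτ h1 h2
      rw [play_node σ h1, play_node τ h2]
      refine ih b (R := restrict R b) ?_ ?_ ?_
      · rintro j _ ⟨r, hr, hj, rfl⟩
        exact (h j r hr).2 b hj
      · exact fun j => ⟨σ j, hσ j, by rintro rfl; exact h1, rfl⟩
      · exact fun j => ⟨τ j, hτ j, by rintro rfl; exact h2, rfl⟩
    have half : ∀ σ τ : I → (node a ch).Strat, (∀ j, σ j ∈ R j) → (∀ j, τ j ∈ R j) →
        P a (play _ σ) (play _ τ) := by
      intro σ τ hσ hτ
      -- Nondomination of `σ a` by `τ a` compares only one pair of profiles; constancy within the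
      -- subtrees transfers the comparison to `σ` and `τ`.
      obtain ⟨ρ, ρ', h1, h2, h3, h4, h5⟩ :=
        (h a (σ a) (hσ a)).1 rfl (fun i _ => ⟨_, hσ i⟩) (τ a) (hτ a)
      have m1 : ∀ j, ρ j ∈ R j := fun j => by
        by_cases hj : j = a
        · subst hj; rw [h1]; exact hσ _
        · exact h3 j hj
      have m2 : ∀ j, ρ' j ∈ R j := fun j => by
        by_cases hj : j = a
        · subst hj; rw [h2]; exact hτ _
        · rw [h4 j hj]; exact h3 j hj
      rw [key _ σ ρ hσ m1 rfl (by rw [h1]), key _ τ ρ' hτ m2 rfl (by rw [h2])]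
      exact h5
    exact hP.antisymm a _ _ (half σ τ hσ hτ) (half τ σ hτ hσ)

/-! #### Existence of justified best replies -/

theorem exists_forall_eq_of_antitone {α : Type*} [Finite α] [PartialOrder α] {f : ℕ → α}
    (hf : Antitone f) : ∃ K, ∀ k, K ≤ k → f k = f K := by
  obtain ⟨K, hK⟩ := WellFoundedGT.monotone_chain_condition (α := αᵒᵈ) ⟨f, hf⟩
  exact ⟨K, fun k hk => (hK k hk).symm⟩

/-- Some opponents' profile belongs to all the nonempty members of a chain. -/
theorem exists_top [Finite I] {t : GameTree I Z} {R : ℕ → I → Set t.Strat} (hR : Antitone R)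
    (j : I) : ∃ q : I → t.Strat, ∀ k, (∀ i, i ≠ j → (R k i).Nonempty) →
      ∀ i, i ≠ j → q i ∈ R k i := by
  classical
  by_cases hall : ∀ k, ∀ i, i ≠ j → (R k i).Nonempty
  · obtain ⟨K, hK⟩ := exists_forall_eq_of_antitone hR
    refine ⟨fun i => if h : i ≠ j then (hall K i h).some else Classical.choice inferInstance,
      fun k _ i hi => ?_⟩
    beta_reduce
    rw [dif_pos hi]
    rcases le_total k K with h | h
    · exact hR h i (hall K i hi).some_mem
    · rw [hK k h]; exact (hall K i hi).some_mem
  · rw [not_forall] at hall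
    -- `n` is the first level at which some opponent's set is empty. Every level that matters lies
    -- below it, so level `n - 1` is contained in all of them.
    set n := Nat.find hall with hn
    have hlt : ∀ k, (∀ i, i ≠ j → (R k i).Nonempty) → k < n := by
      intro k hk
      by_contra hle
      exact Nat.find_spec hall fun i hi => (hk i hi).mono (hR (not_lt.1 hle) i)
    rcases Nat.eq_zero_or_pos n with h0 | h0
    · exact ⟨fun _ => Classical.choice inferInstance, fun k hk => by have := hlt k hk; omega⟩
    · have hne : ∀ i, i ≠ j → (R (n - 1) i).Nonempty :=
        not_not.1 (Nat.find_min hall (m := n - 1) (by omega))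
      refine ⟨fun i => if h : i ≠ j then (hne i h).some else Classical.choice inferInstance,
        fun k hk i hi => ?_⟩
      beta_reduce
      rw [dif_pos hi]
      exact hR (by have := hlt k hk; omega) i (hne i hi).some_mem

/-- One plan is justified at all levels simultaneously because the same `q` can serve as the
justifying profile at every level that imposes a condition. The plan is built by backward induction
against `q`. -/
theorem exists_justified_reply [Finite I] (hP : LinearPref P) {t : GameTree I Z}
    {R : ℕ → I → Set t.Strat} (hR : Antitone R) (j : I) (q : I → t.Strat)
    (hq : ∀ k, (∀ i, i ≠ j → (R k i).Nonempty) → ∀ i, i ≠ j → q i ∈ R k i) :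
    ∃ σ : I → t.Strat, (∀ i, i ≠ j → σ i = q i) ∧ NoGain P t j σ ∧
      ∀ k, Justified P t (R k) j (σ j) := by
  classical
  induction t with
  | leaf z => exact ⟨q, fun _ _ => rfl, fun _ _ => hP.refl _ _, fun _ => trivial⟩
  | node a ch ih =>
    have hne : ∀ b k, (∀ i, i ≠ j → (restrict (R k) b i).Nonempty) →
        ∀ i, i ≠ j → (R k i).Nonempty := fun b k h i hi => by
      obtain ⟨_, r, hr, -⟩ := h i hi
      exact ⟨r, hr⟩
    by_cases hj : j = a
    · subst hj
      have hb : ∀ b, ∃ σ : I → (ch b).Strat, (∀ i, i ≠ j → σ i = (q i).2 b) ∧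
          NoGain P (ch b) j σ ∧ ∀ k, Justified P (ch b) (restrict (R k) b) j (σ j) := fun b =>
        ih b (antitone_restrict hR b) (fun i => (q i).2 b) fun k h i hi =>
          ⟨q i, hq k (hne b k h) i hi, fun e => absurd e hi, rfl⟩
      choose τ h1 h2 h3 using hb
      obtain ⟨d, hd⟩ : ∃ d, P j (play _ (τ d)) (play _ (τ (!d))) :=
        (hP.total j (play _ (τ true)) (play _ (τ false))).elim (fun h => ⟨true, h⟩)
          fun h => ⟨false, h⟩
      obtain ⟨r, hr1, hr2⟩ : ∃ r : (node j ch).Strat, r.1 = d ∧ ∀ b, r.2 b = τ b j :=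
        ⟨(d, fun b => τ b j), rfl, fun _ => rfl⟩
      have hτ : ∀ b, (fun i => (Function.update q j r i).2 b) = τ b := fun b => by
        funext i
        by_cases hi : i = j
        · subst hi; simp [hr2]
        · simp [hi, h1 b i hi]
      have hro : (Function.update q j r j).1 = d := by simp [hr1]
      have hng : NoGain P (node j ch) j (Function.update q j r) := by
        refine noGain_node_self hP hro (by rw [hτ]; exact h2 d) (e := play _ (τ (!d)))
          (by rw [hτ]; exact hd) fun b hb ρ hρ => ?_
        obtain rfl : b = !d := (Bool.eq_or_eq_not b d).resolve_left hb
        refine h2 _ ρ fun i hi => ?_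
        rw [hρ i hi, h1 _ i hi]; simp [hi]
      refine ⟨Function.update q j r, fun i hi => by simp [hi], hng, fun k => ⟨fun _ hk => ?_, ?_⟩⟩
      · exact ⟨_, rfl, fun i hi => by simpa [hi] using hq k hk i hi, hng⟩
      · intro b _
        have := h3 b k
        rwa [← hτ b] at this
    · set d := (q a).1 with hd
      obtain ⟨τ, h1, h2, h3⟩ := ih d (antitone_restrict hR d) (fun i => (q i).2 d)
        fun k h i hi => ⟨q i, hq k (hne d k h) i hi, by rintro rfl; rfl, rfl⟩
      -- `q` does not enter `ch (!d)`, so it need not lie in the restrictions there; a fresh profile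
      -- takes its place.
      obtain ⟨q', hq'⟩ := exists_top (antitone_restrict hR (!d)) j
      obtain ⟨τ', -, -, h3'⟩ := ih (!d) (antitone_restrict hR (!d)) q' hq'
      obtain ⟨r, -, hr1, hr2⟩ := exists_strat (a := a) (ch := ch) d d (τ j) (τ' j)
      have hτ : (fun i => (Function.update q j r i).2 d) = τ := by
        funext i
        by_cases hi : i = j
        · subst hi; simp [hr1]
        · simp [hi, h1 i hi]
      refine ⟨Function.update q j r, fun i hi => by simp [hi], ?_, fun k => ⟨fun e => absurd e hj,
        fun b _ => ?_⟩⟩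
      · refine noGain_node_of_ne hj (d := d) ?_ (by rw [hτ]; exact h2)
        rw [Function.update_of_ne (Ne.symm hj)]
      · rw [Function.update_self]
        rcases Bool.eq_or_eq_not b d with rfl | rfl
        · rw [hr1]; exact h3 k
        · rw [hr2]; exact h3' k

theorem exists_justified [Finite I] (hP : LinearPref P) {t : GameTree I Z}
    {R : ℕ → I → Set t.Strat} (hR : Antitone R) (j : I) :
    ∃ s : t.Strat, ∀ k, Justified P t (R k) j s := by
  obtain ⟨q, hq⟩ := exists_top hR j
  obtain ⟨σ, -, -, h⟩ := exists_justified_reply hP hR j q hq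
  exact ⟨_, h⟩

end Preferences
end GameTree

namespace GameTree

variable {I Z : Type*} {P : I → Z → Z → Prop}

theorem robust_succ_subset {t : GameTree I Z} (R : ℕ → I → Set t.Strat) (c : I → Option Z)
    (n : ℕ) (j : I) : robust P R c (n + 1) j ⊆ robust P R c n j := by
  induction n generalizing j with
  | zero => exact fun _ _ => trivial
  | succ m ih =>
    intro s hs
    refine ⟨fun k hk => hs.1 k (by omega), fun e he => ?_⟩
    obtain ⟨σ, h1, h2, h3⟩ := hs.2 e he
    exact ⟨σ, h1, fun i hi => ih i (h2 i hi), h3⟩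

theorem robust_congr {t : GameTree I Z} {R R' : ℕ → I → Set t.Strat} (c : I → Option Z)
    {n : ℕ} (h : ∀ k < n, R k = R' k) : robust P R c n = robust P R' c n := by
  induction n with
  | zero => rfl
  | succ m ih =>
    have h1 := ih fun k hk => h k (by omega)
    funext j
    ext s
    refine and_congr (forall_congr' fun k => ?_) (by rw [h1])
    exact forall_congr' fun hk => by rw [h k (by omega)]

/-! #### Passing to the immediate subtrees -/

section Node

variable [DecidableEq I] {a : I} {ch : Bool → GameTree I Z} {R : ℕ → I → Set (node a ch).Strat}
  {c : I → Option Z} {d : Bool} {e : Z} {N : ℕ}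

/-- Robust strategies of a subtree extend to the whole tree, provided that the player at the root
can be deterred from choosing the other subtree. -/
theorem robust_of_restrict (hP : LinearPref P) (hR : Antitone R)
    (hce : ∀ e₀, c a = some e₀ → P a e e₀)
    (hcl : ∀ n < N, ∀ j, robust P R c n j ⊆ R n j)
    (hdet : ∀ m < N, ∃ q : I → (ch (!d)).Strat,
      (∀ j, j ≠ a → ∀ k < m, Justified P (ch (!d)) (restrict (R k) (!d)) j (q j)) ∧
      ∀ σ : I → (ch (!d)).Strat, (∀ j, j ≠ a → σ j = q j) → P a e (play _ σ))
    (n : ℕ) (hn : n ≤ N) (j : I) (r : (node a ch).Strat)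
    (hr : r.2 d ∈ robust P (fun k => restrict (R k) d) (Function.update c a (some e)) n j)
    (hra : j = a → r.1 = d)
    (hrn : j ≠ a → ∀ k < n, Justified P _ (restrict (R k) (!d)) j (r.2 (!d))) :
    r ∈ robust P R c n j := by
  induction n generalizing j r with
  | zero => trivial
  | succ m ih =>
    obtain ⟨q, hq1, hq2⟩ := hdet m hn
    -- opponents' profiles extend
    have ext : ∀ σd : I → (ch d).Strat, (∀ i, i ≠ j → σd i ∈
        robust P (fun k => restrict (R k) d) (Function.update c a (some e)) m i) →
        ∃ σ : I → (node a ch).Strat, σ j = r ∧ ∀ i, i ≠ j → (σ i).1 = d ∧ (σ i).2 d = σd i ∧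
          (σ i).2 (!d) = q i ∧ σ i ∈ robust P R c m i := by
      intro σd hσ
      have h1 : ∀ i, ∃ ρ : (node a ch).Strat, ρ.1 = d ∧ ρ.2 d = σd i ∧ ρ.2 (!d) = q i :=
        fun i => exists_strat d d (σd i) (q i)
      choose ρ h1 h2 h3 using h1
      refine ⟨Function.update ρ j r, by simp, fun i hi => ?_⟩
      rw [Function.update_of_ne hi]
      refine ⟨h1 i, h2 i, h3 i, ih (by omega) i (ρ i) (by rw [h2]; exact hσ i hi)
        (fun _ => h1 i) fun hia k hk => ?_⟩
      rw [h3]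
      exact hq1 i hia k hk
    rcases eq_or_ne a j with rfl | hj
    · obtain ⟨σd, h1, h2, h3, h4⟩ := hr.2 e (by simp)
      obtain ⟨σ, hσa, hσ⟩ := ext σd h2
      have hsub : (fun i => (σ i).2 d) = σd := by
        funext i
        by_cases hi : i = a
        · subst hi; rw [hσa, h1]
        · exact (hσ i hi).2.1
      have hroot : (σ a).1 = d := by rw [hσa]; exact hra rfl
      have hng : NoGain P (node a ch) a σ := by
        refine noGain_node_self hP hroot (by rw [hsub]; exact h3) (e := e)
          (by rw [hsub]; exact h4) fun b hb τ hτ => ?_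
        obtain rfl : b = !d := (Bool.eq_or_eq_not b d).resolve_left hb
        exact hq2 τ fun i hi => by rw [hτ i hi, (hσ i hi).2.2.1]
      refine ⟨fun k hk => ⟨fun _ _ => ⟨σ, hσa, fun i hi => ?_, hng⟩, fun b hb => ?_⟩,
        fun e₀ he₀ => ⟨σ, hσa, fun i hi => (hσ i hi).2.2.2, hng, ?_⟩⟩
      · exact hR hk i (hcl m hn i (hσ i hi).2.2.2)
      · obtain rfl : d = b := (hra rfl).symm.trans (hb rfl)
        exact hr.1 k hk
      · rw [play_node σ hroot, hsub]
        exact hP.trans _ _ _ _ h4 (hce e₀ he₀)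
    · refine ⟨fun k hk => ⟨fun h => absurd h.symm hj, fun b _ => ?_⟩, fun e₀ he₀ => ?_⟩
      · rcases Bool.eq_or_eq_not b d with rfl | rfl
        · exact hr.1 k hk
        · exact hrn hj.symm k (by omega)
      · obtain ⟨σd, h1, h2, h3, h4⟩ := hr.2 e₀ (by rw [Function.update_of_ne hj.symm, he₀])
        obtain ⟨σ, hσj, hσ⟩ := ext σd h2
        have hsub : (fun i => (σ i).2 d) = σd := by
          funext i
          by_cases hi : i = j
          · subst hi; rw [hσj, h1]
          · exact (hσ i hi).2.1
        have hroot : (σ a).1 = d := (hσ a hj).1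
        refine ⟨σ, hσj, fun i hi => (hσ i hi).2.2.2,
          noGain_node_of_ne hj.symm hroot (by rw [hsub]; exact h3), ?_⟩
        rw [play_node σ hroot, hsub]
        exact h4

/-- If the player at the root gets at most `e` in the subtree `ch d`, then her strategies choosing
the other subtree and attaining `e` there survive. -/
theorem robust_subset_restrict_not (hP : LinearPref P) (hR : Antitone R)
    (hce : ∀ e₀, c a = some e₀ → P a e e₀)
    (hcl : ∀ n ≤ N, ∀ j, robust P R c n j ⊆ R n j)
    (hdet : ∀ m < N, ∃ q : I → (ch (!d)).Strat,
      (∀ j, j ≠ a → ∀ k < m, Justified P (ch (!d)) (restrict (R k) (!d)) j (q j)) ∧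
      ∀ σ : I → (ch (!d)).Strat, (∀ j, j ≠ a → σ j = q j) → P a e (play _ σ))
    (hβ : ∀ m ≤ N, ∃ β : I → (ch d).Strat,
      (∀ j, β j ∈ robust P (fun k => restrict (R k) d) (Function.update c a (some e)) m j) ∧
      ∀ σ : I → (ch d).Strat, (∀ j, j ≠ a → σ j = β j) → P a e (play _ σ))
    (n : ℕ) (hn : n ≤ N) (j : I) :
    robust P (fun k => restrict (R k) (!d)) (Function.update (fun _ => none) a (some e)) n j ⊆
      restrict (R n) (!d) j := by
  intro s hs
  have lift := robust_of_restrict hP hR hce (fun n h => hcl n h.le) hdet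
  rcases eq_or_ne a j with rfl | hj
  · obtain ⟨r, hr0, -, hr2⟩ := exists_strat (a := a) (ch := ch) (!d) d
      (Classical.choice inferInstance) s
    refine ⟨r, hcl n hn a ?_, fun _ => hr0, hr2⟩
    cases n with
    | zero => trivial
    | succ m =>
      obtain ⟨σ', h1, h2, h3, h4⟩ := hs.2 e (by simp)
      -- In `ch d` the opponents play `β`, which holds the root player to at most `e`; entering `ch
      -- (!d)`, where `s` attains at least `e`, is then a best reply.
      obtain ⟨β, hβ1, hβ2⟩ := hβ m (by omega)
      have hρ : ∀ i, ∃ ρ : (node a ch).Strat, ρ.1 = d ∧ ρ.2 d = β i ∧ ρ.2 (!d) = σ' i :=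
        fun i => exists_strat d d (β i) (σ' i)
      choose ρ hρ0 hρ1 hρ2 using hρ
      set σ := Function.update ρ a r with hσ
      have hσa : σ a = r := by simp [hσ]
      have hσi : ∀ i, i ≠ a → σ i = ρ i := fun i hi => by simp [hσ, hi]
      have hmem : ∀ i, i ≠ a → σ i ∈ robust P R c m i := by
        intro i hi
        rw [hσi i hi]
        refine lift m (by omega) i _ (by rw [hρ1]; exact hβ1 i) (fun h => absurd h hi)
          fun _ k hk => ?_
        rw [hρ2]
        exact robust_justified (h2 i hi) k hk
      have hsub : (fun i => (σ i).2 (!d)) = σ' := by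
        funext i
        by_cases hi : i = a
        · subst hi; rw [hσa, hr2, h1]
        · rw [hσi i hi, hρ2]
      have hroot : (σ a).1 = !d := by rw [hσa, hr0]
      have hng : NoGain P (node a ch) a σ := by
        refine noGain_node_self hP hroot (by rw [hsub]; exact h3) (e := e)
          (by rw [hsub]; exact h4) fun b hb τ hτ => ?_
        obtain rfl : b = d := by cases b <;> cases d <;> simp_all
        exact hβ2 τ fun i hi => by rw [hτ i hi, hσi i hi, hρ1]
      refine ⟨fun k hk => ⟨fun _ _ => ⟨σ, hσa, fun i hi => ?_, hng⟩, fun b hb => ?_⟩,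
        fun e₀ he₀ => ⟨σ, hσa, hmem, hng, ?_⟩⟩
      · exact hR hk i (hcl m (by omega) i (hmem i hi))
      · obtain rfl : (!d) = b := hr0.symm.trans (hb rfl)
        rw [hr2]
        exact hs.1 k hk
      · rw [play_node σ hroot, hsub]
        exact hP.trans _ _ _ _ h4 (hce e₀ he₀)
  -- A player other than the root player needs robustness only in `ch d`, which `β j` supplies; in
  -- `ch (!d)` justification of `s` suffices.
  · obtain ⟨β, hβ1, -⟩ := hβ n hn
    obtain ⟨r, -, hr1, hr2⟩ := exists_strat (a := a) (ch := ch) d d (β j) s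
    refine ⟨r, hcl n hn j (lift n hn j r (by rw [hr1]; exact hβ1 j) (fun h => absurd h.symm hj)
      fun _ k hk => ?_), fun h => absurd h.symm hj, hr2⟩
    rw [hr2]
    exact robust_justified hs k hk

/-- Robust strategies of the subtree `ch d` survive. -/
theorem robust_subset_restrict [Finite I] (hP : LinearPref P) (hR : Antitone R)
    (hce : ∀ e₀, c a = some e₀ → P a e e₀)
    (hcl : ∀ n ≤ N, ∀ j, robust P R c n j ⊆ R n j)
    (hdet : ∀ m < N, ∃ q : I → (ch (!d)).Strat,
      (∀ j, j ≠ a → ∀ k < m, Justified P (ch (!d)) (restrict (R k) (!d)) j (q j)) ∧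
      ∀ σ : I → (ch (!d)).Strat, (∀ j, j ≠ a → σ j = q j) → P a e (play _ σ))
    (n : ℕ) (hn : n ≤ N) (j : I) :
    robust P (fun k => restrict (R k) d) (Function.update c a (some e)) n j ⊆
      restrict (R n) d j := by
  intro s hs
  obtain ⟨s', hs'⟩ := exists_justified hP (antitone_restrict hR (!d)) j
  obtain ⟨r, hr0, hr1, hr2⟩ := exists_strat (a := a) (ch := ch) d d s s'
  refine ⟨r, hcl n hn j (robust_of_restrict hP hR hce (fun n h => hcl n h.le) hdet n hn j r
    (by rw [hr1]; exact hs) (fun _ => hr0) fun _ k _ => ?_), fun _ => hr0, hr1⟩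
  rw [hr2]
  exact hs' k

end Node

/-! #### The backward induction value and chains of restrictions -/

section Main

variable [DecidableEq I]

variable (P) in
/-- Chains of restrictions that keep all the robust strategies keep an equilibrium attaining the
backward induction value, if no outside option exceeds it. -/
def KeepsValue (t : GameTree I Z) : Prop :=
  ∀ (R : ℕ → I → Set t.Strat) (c : I → Option Z) (N : ℕ), Antitone R →
    (∀ n ≤ N, ∀ j, robust P R c n j ⊆ R n j) → (∀ j e, c j = some e → P j (t.value P) e) →
    ∃ β : I → t.Strat, (∀ j, β j ∈ robust P R c N j) ∧ t.play β = t.value P ∧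
      ∀ j, NoGain P t j β

variable (P) in
/-- If a chain that keeps all the robust strategies ends up with a single outcome, then this is the
backward induction value. -/
def ConvergesToValue (t : GameTree I Z) : Prop :=
  ∀ (R : ℕ → I → Set t.Strat) (c : I → Option Z) (f : I → t.Strat), Antitone R →
    (∀ n j, robust P R c n j ⊆ R n j) → (∀ j, NoGain P t j f) →
    (∀ j k, Justified P t (R k) j (f j)) → (∀ j e, c j = some e → P j (t.play f) e) →
    ∀ N, (∀ σ : I → t.Strat, (∀ j, σ j ∈ R N j) → t.play σ = t.play f) → t.play f = t.value P

variable (P) in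
/-- A player with an outside option at least as good as the backward induction value is deterred
from entering. -/
def Deters (t : GameTree I Z) : Prop :=
  ∀ (R : ℕ → I → Set t.Strat) (a : I) (e : Z) (N : ℕ), Antitone R →
    (∀ n ≤ N, ∀ j, robust P R (Function.update (fun _ => none) a (some e)) n j ⊆ R n j) →
    P a e (t.value P) →
    ∃ q : I → t.Strat, (∀ j, j ≠ a → ∀ k < N, Justified P t (R k) j (q j)) ∧
      ∀ σ : I → t.Strat, (∀ j, j ≠ a → σ j = q j) → P a e (t.play σ)

/-- Without a deterrent, entering stays profitable along any continuation of the chain. Its limit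
would then have a single equilibrium outcome better than `e` for `a`, yet equal to the value. -/
theorem ConvergesToValue.deters [Finite I] (hP : LinearPref P) {t : GameTree I Z}
    (ht : ConvergesToValue P t) : Deters P t := by
  intro R a e N hR hcl hV
  by_contra! H
  set c : I → Option Z := Function.update (fun _ => none) a (some e) with hc
  have hcn : ∀ j, j ≠ a → c j = none := fun j hj => by simp [hc, hj]
  -- continue the chain from level `N` on
  let X : ℕ → I → Set t.Strat := fun n => Nat.rec (robust P R c N)
    (fun _ Y j => {s ∈ Y j | Justified P t Y j s}) n
  let R' : ℕ → I → Set t.Strat := fun k => if k < N then R k else X (k - N)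
  have hlt : ∀ k, k < N → R' k = R k := fun k hk => if_pos hk
  have hge : ∀ k, N ≤ k → R' (k + 1) = fun j => {s ∈ R' k j | Justified P t (R' k) j s} := by
    intro k hk
    have h1 : R' (k + 1) = X (k + 1 - N) := if_neg (by omega)
    have h2 : R' k = X (k - N) := if_neg (by omega)
    rw [h1, h2, Nat.succ_sub hk]
  have hN : R' N = robust P R c N := by
    have h1 : R' N = X (N - N) := if_neg (by omega)
    rw [h1, Nat.sub_self]
    rfl
  have hrob : ∀ n ≤ N, robust P R' c n = robust P R c n := fun n hn =>
    robust_congr c fun k hk => hlt k (by omega)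
  have hR' : Antitone R' := by
    refine antitone_nat_of_succ_le fun k => ?_
    rcases Nat.lt_trichotomy (k + 1) N with h | h | h
    · rw [hlt _ h, hlt k (by omega)]; exact hR (by omega)
    · rw [h, hN, hlt k (by omega)]
      exact fun j => (hcl N le_rfl j).trans (hR (by omega) j)
    · rw [hge k (by omega)]
      exact fun j s hs => hs.1
  -- Beyond level `N` each step removes only unjustified plans, and robust plans are justified.
  have hcl' : ∀ n j, robust P R' c n j ⊆ R' n j := by
    intro n
    induction n with
    | zero =>
      intro j
      rcases Nat.eq_zero_or_pos N with h | h
      · subst h; rw [hN]; exact fun _ _ => trivial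
      · rw [hrob 0 (by omega), hlt 0 h]; exact hcl 0 (by omega) j
    | succ n ih =>
      intro j
      rcases Nat.lt_trichotomy (n + 1) N with h | h | h
      · rw [hrob _ h.le, hlt _ h]; exact hcl _ h.le j
      · rw [hrob _ h.le, h, hN]
      · rw [hge n (by omega)]
        exact fun s hs => ⟨ih j (robust_succ_subset R' c n j hs), hs.1 n le_rfl⟩
  -- a justified equilibrium
  choose f₀ hf₀ using fun j => exists_justified hP hR' j
  have hmem₀ : ∀ j, j ≠ a → ∀ k, f₀ j ∈ robust P R' c k j := fun j hj k =>
    mem_robust_of_none (hcn j hj) fun k _ => hf₀ j k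
  obtain ⟨f, hf1, hf2, hf3⟩ := exists_justified_reply hP hR' a f₀
    fun k _ i hi => hcl' k i (hmem₀ i hi k)
  have hJ : ∀ j k, Justified P t (R' k) j (f j) := by
    intro j k
    by_cases hj : j = a
    · subst hj; exact hf3 k
    · rw [hf1 j hj]; exact hf₀ j k
  obtain ⟨σ, hσ1, hσ2⟩ := H f fun j _ k hk => by rw [← hlt k hk]; exact hJ j k
  -- The opponents in `f` are justified, so some reply `σ` of `a` yields strictly more than `e`; the
  -- best reply `f a` does at least as well.
  have hw : ¬ P a e (t.play f) := fun h => hσ2 (hP.trans _ _ _ _ h (hf2 σ hσ1))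
  have hw' : P a (t.play f) e := (hP.total _ _ _).resolve_left hw
  have hfr : ∀ n j, f j ∈ robust P R' c n j := by
    intro n j
    by_cases hj : j = a
    · subst hj
      cases n with
      | zero => trivial
      | succ m =>
        refine ⟨fun k _ => hf3 k, fun e' he' => ⟨f, rfl, fun i hi => ?_, hf2, ?_⟩⟩
        · rw [hf1 i hi]; exact hmem₀ i hi m
        · simp only [hc, Function.update_self, Option.some.injEq] at he'
          exact he' ▸ hw'
    · rw [hf1 j hj]; exact hmem₀ j hj n
  have hfm : ∀ n j, f j ∈ R' n j := fun n j => hcl' n j (hfr n j)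
  obtain ⟨K, hK⟩ := exists_forall_eq_of_antitone hR'
  -- At `M` the chain is past `N` and stationary, so every remaining plan is justified with respect
  -- to the remaining ones and the outcome is unique.
  set M := max K N with hM
  have hconst : ∀ τ : I → t.Strat, (∀ j, τ j ∈ R' M j) → t.play τ = t.play f := by
    intro τ hτ
    refine play_eq_of_undominated hP (R := R' M) (fun j s hs => ?_) hτ (hfm M)
    rw [hK M (le_max_left _ _), ← hK (M + 1) ((le_max_left _ _).trans (Nat.le_succ _)),
      hge M (le_max_right _ _)] at hs
    exact hs.2.undominated
  -- For `j ≠ a`, a justified best reply to `f` also remains in the chain, hence gives the same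
  -- outcome as `f j`.
  have hng : ∀ j, NoGain P t j f := by
    intro j
    by_cases hj : j = a
    · subst hj; exact hf2
    · obtain ⟨τ, h1, h2, h3⟩ := exists_justified_reply hP hR' j f fun k _ i _ => hfm k i
      have h4 : t.play τ = t.play f := by
        refine hconst τ fun i => ?_
        by_cases hi : i = j
        · subst hi; exact hcl' M i (mem_robust_of_none (hcn i hj) fun k _ => h3 k)
        · rw [h1 i hi]; exact hfm M i
      intro σ' hσ'
      rw [← h4]
      exact h2 σ' fun i hi => by rw [hσ' i hi, h1 i hi]
  have := ht R' c f hR' hcl' hng hJ (fun j e' he' => by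
    by_cases hj : j = a
    · subst hj
      simp only [hc, Function.update_self, Option.some.injEq] at he'
      exact he' ▸ hw'
    · simp [hcn j hj] at he') M hconst
  exact hw (this ▸ hV)

/-- The profile combines an equilibrium of the root player's best subtree with deterrents in the
other one. The root player's outside option is `e` in both subtrees. -/
theorem KeepsValue.node [Finite I] (hP : LinearPref P) {a : I} {ch : Bool → GameTree I Z}
    (hK : ∀ b, KeepsValue P (ch b)) (hD : ∀ b, Deters P (ch b)) : KeepsValue P (node a ch) := by
  intro R c N hR hcl hc
  obtain ⟨d, hd1, hd2⟩ := value_node hP a ch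
  rw [hd1] at hc ⊢
  set e := value P (ch d) with he
  have hce : ∀ e₀, c a = some e₀ → P a e e₀ := hc a
  have hc' : ∀ j e₀, Function.update c a (some e) j = some e₀ → P j e e₀ := by
    intro j e₀ h
    by_cases hj : j = a
    · subst hj
      simp only [Function.update_self, Option.some.injEq] at h
      exact h ▸ hP.refl _ _
    · rw [Function.update_of_ne hj] at h
      exact hc j e₀ h
  have keep : ∀ m, (∀ n ≤ m, ∀ j, robust P (fun k => restrict (R k) d)
      (Function.update c a (some e)) n j ⊆ restrict (R n) d j) →
      ∃ β : I → (ch d).Strat,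
        (∀ j, β j ∈ robust P (fun k => restrict (R k) d) (Function.update c a (some e)) m j) ∧
        play _ β = e ∧ ∀ j, NoGain P (ch d) j β := fun m h =>
    hK d _ _ m (antitone_restrict hR d) h hc'
  have det : ∀ m, (∀ n ≤ m, ∀ j, robust P (fun k => restrict (R k) (!d))
      (Function.update (fun _ => none) a (some e)) n j ⊆ restrict (R n) (!d) j) →
      ∃ q : I → (ch (!d)).Strat,
        (∀ j, j ≠ a → ∀ k < m, Justified P (ch (!d)) (restrict (R k) (!d)) j (q j)) ∧
        ∀ σ : I → (ch (!d)).Strat, (∀ j, j ≠ a → σ j = q j) → P a e (play _ σ) := fun m h =>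
    hD (!d) _ a e m (antitone_restrict hR (!d)) h hd2
  have step : ∀ n ≤ N, (∀ m < n, ∃ q : I → (ch (!d)).Strat,
        (∀ j, j ≠ a → ∀ k < m, Justified P (ch (!d)) (restrict (R k) (!d)) j (q j)) ∧
        ∀ σ : I → (ch (!d)).Strat, (∀ j, j ≠ a → σ j = q j) → P a e (play _ σ)) →
      (∀ k ≤ n, ∀ j, robust P (fun k => restrict (R k) d) (Function.update c a (some e)) k j ⊆
        restrict (R k) d j) ∧
      ∀ k ≤ n, ∀ j, robust P (fun k => restrict (R k) (!d))
        (Function.update (fun _ => none) a (some e)) k j ⊆ restrict (R k) (!d) j := by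
    intro n hn hdet
    have h1 := robust_subset_restrict hP hR hce (fun k hk => hcl k (hk.trans hn)) hdet
    refine ⟨h1, robust_subset_restrict_not hP hR hce (fun k hk => hcl k (hk.trans hn)) hdet
      fun m hm => ?_⟩
    obtain ⟨β, h2, h3, h4⟩ := keep m fun k hk => h1 k (hk.trans hm)
    exact ⟨β, h2, fun σ hσ => h3 ▸ h4 a σ hσ⟩
  -- Induction on the level breaks the circle: deterrence at levels below `n` gives the inclusions
  -- up to `n` in both subtrees, and these give deterrence at `n`.
  have all : ∀ n ≤ N, ∃ q : I → (ch (!d)).Strat,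
        (∀ j, j ≠ a → ∀ k < n, Justified P (ch (!d)) (restrict (R k) (!d)) j (q j)) ∧
        ∀ σ : I → (ch (!d)).Strat, (∀ j, j ≠ a → σ j = q j) → P a e (play _ σ) := by
    intro n
    induction n using Nat.strong_induction_on with
    | _ n ih => exact fun hn => det n (step n hn fun m hm => ih m hm (by omega)).2
  have hdet := fun m (hm : m < N) => all m hm.le
  obtain ⟨β, hβ1, hβ2, hβ3⟩ := keep N (step N le_rfl hdet).1
  obtain ⟨q, hq1, hq2⟩ := all N le_rfl
  choose s' hs' using fun j => exists_justified hP (antitone_restrict hR (!d)) j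
  have hρ : ∀ i, ∃ ρ : (GameTree.node a ch).Strat, ρ.1 = d ∧ ρ.2 d = β i ∧ ρ.2 (!d) = q i :=
    fun i => exists_strat d d (β i) (q i)
  choose ρ hρ0 hρ1 hρ2 using hρ
  have hsub : (fun i => (ρ i).2 d) = β := funext hρ1
  refine ⟨ρ, fun j => ?_, ?_, fun j => ?_⟩
  · refine robust_of_restrict hP hR hce (fun n h => hcl n h.le) hdet N le_rfl j _
      (by rw [hρ1]; exact hβ1 j) (fun _ => hρ0 j) fun hj k hk => ?_
    rw [hρ2]
    exact hq1 j hj k hk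
  · rw [play_node ρ (hρ0 a), hsub, hβ2]
  · by_cases hj : j = a
    · subst hj
      refine noGain_node_self hP (hρ0 j) (by rw [hsub]; exact hβ3 j) (e := e)
        (by rw [hsub, hβ2]; exact hP.refl _ _) fun b hb τ hτ => ?_
      obtain rfl : b = !d := (Bool.eq_or_eq_not b d).resolve_left hb
      exact hq2 τ fun i hi => by rw [hτ i hi, hρ2]
    · exact noGain_node_of_ne hj (hρ0 a) (by rw [hsub]; exact hβ3 j)

/-- Here `f` is its own deterrent: its components in the subtree not chosen are justified for the
opponents, and they hold the root player to `e` because `f` is an equilibrium. -/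
theorem ConvergesToValue.node [Finite I] (hP : LinearPref P) {a : I}
    {ch : Bool → GameTree I Z} (hK : ∀ b, KeepsValue P (ch b))
    (hC : ∀ b, ConvergesToValue P (ch b)) : ConvergesToValue P (node a ch) := by
  intro R c f hR hcl hng hJ hc N hN
  obtain ⟨d, hd⟩ : ∃ d, (f a).1 = d := ⟨_, rfl⟩
  have hplay := play_node f hd
  set e := play (GameTree.node a ch) f with he
  have hce : ∀ e₀, c a = some e₀ → P a e e₀ := hc a
  have hJs : ∀ b j, (j = a → (f j).1 = b) → ∀ k,
      Justified P (ch b) (restrict (R k) b) j ((f j).2 b) := fun b j h k => (hJ j k).2 b h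
  have hdet : ∀ m : ℕ, ∃ q : I → (ch (!d)).Strat,
      (∀ j, j ≠ a → ∀ k < m, Justified P (ch (!d)) (restrict (R k) (!d)) j (q j)) ∧
      ∀ σ : I → (ch (!d)).Strat, (∀ j, j ≠ a → σ j = q j) → P a e (play _ σ) := fun m =>
    ⟨fun j => (f j).2 (!d), fun j hj k _ => hJs (!d) j (fun h => absurd h hj) k,
      fun σ hσ => (hng a).other (!d) σ hσ⟩
  have hcl₁ : ∀ n j, robust P (fun k => restrict (R k) d) (Function.update c a (some e)) n j ⊆
      restrict (R n) d j := fun n =>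
    robust_subset_restrict hP hR hce (fun k _ => hcl k) (fun m _ => hdet m) n le_rfl
  have hngd : ∀ j, NoGain P (ch d) j fun i => (f i).2 d := fun j => (hng j).sub hd
  have hJd : ∀ j k, Justified P (ch d) (restrict (R k) d) j ((f j).2 d) := fun j k =>
    hJs d j (by rintro rfl; exact hd) k
  have hc' : ∀ j e₀, Function.update c a (some e) j = some e₀ → P j e e₀ := by
    intro j e₀ h
    by_cases hj : j = a
    · subst hj
      simp only [Function.update_self, Option.some.injEq] at h
      exact h ▸ hP.refl _ _
    · rw [Function.update_of_ne hj] at h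
      exact hc j e₀ h
  have lift : ∀ b (τ : I → (ch b).Strat), (∀ j, τ j ∈ restrict (R N) b j) → play _ τ = e := by
    intro b τ hτ
    choose r hr1 hr2 hr3 using hτ
    rw [← hN r hr1, play_node r (hr2 a rfl)]
    congr 1
    funext i
    exact (hr3 i).symm
  have hVd : e = value P (ch d) := by
    rw [hplay]
    exact hC d _ _ (fun i => (f i).2 d) (antitone_restrict hR d) hcl₁ hngd hJd
      (by rw [← hplay]; exact hc') N (fun τ hτ => by rw [← hplay]; exact lift d τ hτ)
  have hrob : ∀ m j, (f j).2 d ∈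
      robust P (fun k => restrict (R k) d) (Function.update c a (some e)) m j := by
    intro m
    induction m with
    | zero => exact fun _ => trivial
    | succ m ih =>
      refine fun j => ⟨fun k _ => hJd j k, fun e₀ he₀ => ⟨fun i => (f i).2 d, rfl,
        fun i _ => ih i, hngd j, ?_⟩⟩
      rw [← hplay]
      exact hc' j e₀ he₀
  have hcl₂ : ∀ n j, robust P (fun k => restrict (R k) (!d))
      (Function.update (fun _ => none) a (some e)) n j ⊆ restrict (R n) (!d) j := fun n =>
    robust_subset_restrict_not hP hR hce (fun k _ => hcl k) (fun m _ => hdet m)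
      (fun m _ => ⟨fun i => (f i).2 d, hrob m, fun σ hσ => hplay ▸ hngd a σ hσ⟩) n le_rfl
  by_cases hP' : P a e (value P (ch (!d)))
  · obtain ⟨d', h1, h2⟩ := value_node hP a ch
    rw [h1]
    rcases Bool.eq_or_eq_not d' d with rfl | rfl
    · exact hVd
    · rw [Bool.not_not, ← hVd] at h2
      exact hP.antisymm a _ _ hP' h2
  -- If the root player preferred the value of the other subtree, that value would survive there by
  -- `KeepsValue` and so would have to equal `e`.
  · have h3 := (hP.total _ _ _).resolve_left hP'
    obtain ⟨β, h4, h5, -⟩ := hK (!d) _ _ N (antitone_restrict hR (!d)) (fun n _ => hcl₂ n)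
      fun j e₀ h => by
        by_cases hj : j = a
        · subst hj
          simp only [Function.update_self, Option.some.injEq] at h
          exact h ▸ h3
        · simp [Function.update_of_ne hj] at h
    have h6 := lift (!d) β fun j => hcl₂ N j (h4 j)
    rw [h5] at h6
    exact absurd (h6 ▸ hP.refl a _) hP'

theorem keepsValue_and_convergesToValue [Finite I] (hP : LinearPref P) (t : GameTree I Z) :
    KeepsValue P t ∧ ConvergesToValue P t := by
  induction t with
  | leaf z =>
    refine ⟨fun R c N _ _ hc => ⟨fun _ => (), ?_, rfl, fun _ _ _ => hP.refl _ _⟩,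
      fun _ _ _ _ _ _ _ _ _ _ => rfl⟩
    have key : ∀ n j, () ∈ robust P R c n j := by
      intro n
      induction n with
      | zero => exact fun _ => trivial
      | succ m ih =>
        exact fun j => ⟨fun _ _ => trivial, fun e he =>
          ⟨fun _ => (), rfl, fun i _ => ih i, fun _ _ => hP.refl _ _, hc j e he⟩⟩
    exact key N
  | node a ch ih =>
    exact ⟨KeepsValue.node hP (fun b => (ih b).1) fun b => (ih b).2.deters hP,
      ConvergesToValue.node hP (fun b => (ih b).1) fun b => (ih b).2⟩

end Main
end GameTree

namespace PIGame

/-! ### Plays and histories -/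

section General

variable {I A Z : Type*} (G : PIGame I A Z)

theorem next_of_nonterminal {x : List A} (h : G.Nonterminal x) (σ : ∀ i, G.StdStrategy i) :
    G.next σ x = x ++ [(σ (G.mover x) ⟨x, h, rfl⟩).1] := dif_pos h

theorem playFrom_of_terminal {x : List A} (h : ¬ G.Nonterminal x) (σ : ∀ i, G.StdStrategy i) :
    G.playFrom σ x = x :=
  Function.iterate_fixed (show G.next σ x = x from dif_neg h) _

theorem playFrom_next {x : List A} (hx : x ∈ G.hist) (σ : ∀ i, G.StdStrategy i) :
    G.playFrom σ (G.next σ x) = G.playFrom σ x := by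
  -- The number of iterations in `playFrom` suffices to end the play, so one more step changes
  -- nothing.
  have h : G.next σ (G.playFrom σ x) = G.playFrom σ x := dif_neg (G.playFrom_terminal σ hx).2
  rw [← h]
  exact (Function.iterate_succ_apply _ _ _).symm.trans (Function.iterate_succ_apply' _ _ _)

theorem prefix_playFrom (σ : ∀ i, G.StdStrategy i) (x : List A) : x <+: G.playFrom σ x :=
  G.prefix_iterate σ _ x

theorem nonterminal_of_append_mem {x : List A} {a : A} (h : x ++ [a] ∈ G.hist) :
    G.Nonterminal x := ⟨G.of_append_mem _ _ h, a, h⟩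

theorem playFrom_of_prefix {x : List A} (hx : x ∈ G.hist) (σ : ∀ i, G.StdStrategy i)
    (h : x <+: G.play σ) : G.playFrom σ x = G.play σ := by
  induction x using List.reverseRecOn with
  | nil => rfl
  | append_singleton x a ih =>
    have hn := G.nonterminal_of_append_mem hx
    have h1 := ih hn.1 ((List.prefix_append x [a]).trans h)
    rw [← G.playFrom_next hn.1] at h1
    have h2 : G.next σ x = x ++ [a] := by
      have h3 : G.next σ x <+: G.play σ := h1 ▸ G.prefix_playFrom σ _
      rw [G.next_of_nonterminal hn] at h3 ⊢
      exact (List.prefix_of_prefix_length_le h3 h (by simp)).eq_of_length (by simp)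
    rw [← h2, h1]

theorem append_prefix_play_iff {x : List A} {a : A} (hx : x ++ [a] ∈ G.hist)
    (σ : ∀ i, G.StdStrategy i) : x ++ [a] <+: G.play σ ↔ x <+: G.play σ ∧
      (σ (G.mover x) ⟨x, G.nonterminal_of_append_mem hx, rfl⟩).1 = a := by
  have hn := G.nonterminal_of_append_mem hx
  have key : x <+: G.play σ → G.next σ x <+: G.play σ := fun h => by
    have h1 := G.playFrom_of_prefix hn.1 σ h
    rw [← G.playFrom_next hn.1] at h1
    exact h1 ▸ G.prefix_playFrom σ _
  constructor
  · intro h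
    have h0 := (List.prefix_append x [a]).trans h
    refine ⟨h0, ?_⟩
    have h1 := key h0
    rw [G.next_of_nonterminal hn] at h1
    simpa using (List.prefix_of_prefix_length_le h1 h (by simp)).eq_of_length (by simp)
  · rintro ⟨h, h1⟩
    have h2 := key h
    rwa [G.next_of_nonterminal hn, h1] at h2

/-- The reached histories are those along which every player follows the prescribed actions. -/
theorem prefix_play_iff {x : List A} (hx : x ∈ G.hist) (σ : ∀ i, G.StdStrategy i) :
    x <+: G.play σ ↔ ∀ y a, y ++ [a] <+: x → ∀ i, ∀ h : G.Nonterminal y ∧ G.mover y = i,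
      (σ i ⟨y, h⟩).1 = a := by
  induction x using List.reverseRecOn with
  | nil => simp
  | append_singleton x a ih =>
    rw [G.append_prefix_play_iff hx, ih (G.of_append_mem _ _ hx)]
    constructor
    · rintro ⟨h1, h2⟩ y b hy i ⟨h, rfl⟩
      rcases List.prefix_concat_iff.1 hy with h3 | h3
      · obtain ⟨rfl, h4⟩ := List.append_inj' h3 rfl
        obtain rfl : b = a := by simpa using h4
        exact h2
      · exact h1 y b h3 _ _
    · intro h
      exact ⟨fun y b hy => h y b (hy.trans (List.prefix_append _ _)),
        h x a List.prefix_rfl _ _⟩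

theorem exists_follows {x : List A} (hx : x ∈ G.hist) (j : I) : ∃ τ : G.StdStrategy j,
    ∀ y a, y ++ [a] <+: x → ∀ h : G.Nonterminal y ∧ G.mover y = j, (τ ⟨y, h⟩).1 = a := by
  have hav : ∀ h : G.InfoSet j, ∃ b : {b : A // b ∈ G.avail h.1},
      ∀ a, h.1 ++ [a] <+: x → b.1 = a := by
    intro h
    by_cases hex : ∃ a, h.1 ++ [a] <+: x
    · obtain ⟨a, ha⟩ := hex
      refine ⟨⟨a, G.prefix_mem ha hx⟩, fun b hb => ?_⟩
      simpa using (List.prefix_of_prefix_length_le ha hb (by simp)).eq_of_length (by simp)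
    · exact ⟨⟨_, h.2.1.2.some_mem⟩, fun a ha => absurd ⟨a, ha⟩ hex⟩
  choose τ hτ using hav
  exact ⟨τ, fun y a hy h => hτ ⟨y, h⟩ a hy⟩

theorem allows_iff {x : List A} (hx : x ∈ G.hist) {i : I} (s : G.StdStrategy i) :
    G.Allows s x ↔ ∀ y a, y ++ [a] <+: x → ∀ h : G.Nonterminal y ∧ G.mover y = i,
      (s ⟨y, h⟩).1 = a := by
  classical
  constructor
  · rintro ⟨σ, rfl, h⟩ y a hy
    exact (G.prefix_play_iff hx σ).1 h y a hy i
  · intro hs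
    choose τ hτ using G.exists_follows hx
    refine ⟨Function.update τ i s, by simp, ?_⟩
    rw [G.prefix_play_iff hx]
    intro y a hy j h
    by_cases hj : j = i
    · subst hj
      simpa using hs y a hy h
    · simpa [hj] using hτ j y a hy h

theorem prefix_play_of_allows {x : List A} (hx : x ∈ G.hist) {σ : ∀ i, G.StdStrategy i}
    (h : ∀ i, G.Allows (σ i) x) : x <+: G.play σ :=
  (G.prefix_play_iff hx σ).2 fun y a hy i => (G.allows_iff hx (σ i)).1 (h i) y a hy

theorem allows_append_iff {x : List A} {a : A} (hx : x ++ [a] ∈ G.hist) {i : I}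
    (s : G.StdStrategy i) : G.Allows s (x ++ [a]) ↔ G.Allows s x ∧
      ∀ h : G.Nonterminal x ∧ G.mover x = i, (s ⟨x, h⟩).1 = a := by
  rw [G.allows_iff hx, G.allows_iff (G.of_append_mem _ _ hx)]
  constructor
  · exact fun h => ⟨fun y b hy => h y b (hy.trans (List.prefix_append _ _)),
      h x a List.prefix_rfl⟩
  · rintro ⟨h1, h2⟩ y b hy
    rcases List.prefix_concat_iff.1 hy with h3 | h3
    · obtain ⟨rfl, h4⟩ := List.append_inj' h3 rfl
      obtain rfl : b = a := by simpa using h4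
      exact h2
    · exact h1 y b h3

theorem allows_nil {i : I} (s : G.StdStrategy i) : G.Allows s [] :=
  (G.allows_iff G.nil_mem s).2 fun y a h => by simp at h

/-! ### Behavioral classes and the profiles reaching a history -/

/-- The strategy of a standard strategy. -/
def toStrategy {i : I} (s : G.StdStrategy i) : G.Strategy i := Quotient.mk (G.behavioralSetoid i) s

theorem toStrategy_out {i : I} (s : G.Strategy i) : G.toStrategy s.out = s := Quotient.out_eq s

theorem path_toStrategy (σ : ∀ i, G.StdStrategy i) :
    G.path (fun i => G.toStrategy (σ i)) = G.play σ := G.path_mk σ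

theorem toStrategy_update_out [DecidableEq I] {i : I} (s : G.StdStrategy i)
    (S : ∀ j, G.Strategy j) (h : S i = G.toStrategy s) :
    (fun j => G.toStrategy (Function.update (fun j => (S j).out) i s j)) = S := by
  funext j
  by_cases hj : j = i
  · subst hj; rw [Function.update_self]; exact h.symm
  · rw [Function.update_of_ne hj]; exact G.toStrategy_out _

theorem mem_reachOwn_iff {i : I} {s : G.StdStrategy i} {x : List A} :
    G.toStrategy s ∈ G.reachOwn i x ↔ G.Allows s x := by
  classical
  constructor
  · rintro ⟨S, hS, h⟩
    refine ⟨Function.update (fun j => (S j).out) i s, by simp, ?_⟩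
    rw [← G.path_toStrategy, G.toStrategy_update_out s S h]
    exact hS
  · rintro ⟨σ, rfl, h⟩
    exact ⟨fun j => G.toStrategy (σ j), by rw [← G.path_toStrategy] at h; exact h, rfl⟩

theorem allows_out_iff {i : I} {s : G.Strategy i} {x : List A} :
    G.Allows s.out x ↔ s ∈ G.reachOwn i x := by
  rw [← G.mem_reachOwn_iff, toStrategy_out]

@[simp] theorem join_self {i : I} (s : G.Strategy i) (t : G.Opp i) : G.join s t i = s := by
  simp [join]

theorem join_of_ne {i : I} (s : G.Strategy i) (t : G.Opp i) {j : I} (h : j ≠ i) :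
    G.join s t j = t ⟨j, h⟩ := by
  simp [join, h]

/-- The opponents' part of a profile. -/
def opponents (i : I) (S : ∀ j, G.Strategy j) : G.Opp i := fun j => S j.1

theorem join_opponents {i : I} {s : G.Strategy i} {S : ∀ j, G.Strategy j} (h : S i = s) :
    G.join s (G.opponents i S) = S := by
  funext j
  by_cases hj : j = i
  · subst hj; rw [join_self, h]
  · exact G.join_of_ne _ _ hj

theorem outcome_toStrategy {x : List A} (hx : x ∈ G.hist) {σ : ∀ j, G.StdStrategy j}
    (h : ∀ j, G.Allows (σ j) x) :
    G.outcome (fun j => G.toStrategy (σ j)) = G.result (G.playFrom σ x) := by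
  rw [outcome, G.path_toStrategy, G.playFrom_of_prefix hx σ (G.prefix_play_of_allows hx h)]

/-- The profiles reaching a history form a product, since each player only has to follow her own
actions along it. -/
theorem mem_reachOpp_iff {i : I} {x : List A} (hx : x ∈ G.hist) {t : G.Opp i} :
    t ∈ G.reachOpp i x ↔ ∀ j, t j ∈ G.reachOwn j.1 x := by
  classical
  constructor
  · rintro ⟨S, hS, rfl⟩ j
    exact ⟨S, hS, rfl⟩
  · intro h
    obtain ⟨τ, hτ⟩ := G.exists_follows hx i
    refine ⟨G.join (G.toStrategy τ) t, ?_, funext fun j => G.join_of_ne _ _ j.2⟩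
    refine G.prefix_play_of_allows hx fun j => G.allows_out_iff.2 ?_
    by_cases hj : j = i
    · subst hj
      rw [join_self]
      exact G.mem_reachOwn_iff.2 ((G.allows_iff hx τ).2 hτ)
    · rw [G.join_of_ne _ _ hj]
      exact h ⟨j, hj⟩

end General
end PIGame

namespace PIGame

/-! ### Games with two actions -/

section Binary

open GameTree

variable {I Z : Type*} (G : PIGame I Bool Z)

theorem append_mem {x : List Bool} (h : G.Nonterminal x) (b : Bool) : x ++ [b] ∈ G.hist := by
  obtain ⟨-, a, ha⟩ := h
  rcases Bool.eq_or_eq_not b a with rfl | rfl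
  · exact ha
  · obtain ⟨c, hc, h⟩ := G.two_actions x a ha
    rwa [(Bool.eq_or_eq_not c a).resolve_left hc] at h

/-- The tree `t` represents the subgame that starts at the history `x`. -/
def Represents : GameTree I Z → List Bool → Prop
  | leaf z, x => x ∈ G.hist ∧ ¬ G.Nonterminal x ∧ G.result x = z
  | node a ch, x => G.Nonterminal x ∧ G.mover x = a ∧ ∀ b, Represents (ch b) (x ++ [b])

theorem Represents.mem {G : PIGame I Bool Z} {t : GameTree I Z} {x : List Bool}
    (h : G.Represents t x) : x ∈ G.hist := by
  cases t with
  | leaf => exact h.1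
  | node => exact h.1.1

theorem exists_represents {x : List Bool} (hx : x ∈ G.hist) : ∃ t, G.Represents t x := by
  induction hn : G.hist.ncard - x.length using Nat.strong_induction_on generalizing x with
  | _ n ih =>
    by_cases h : G.Nonterminal x
    · have hb : ∀ b, ∃ t, G.Represents t (x ++ [b]) := fun b => by
        have h1 := G.append_mem h b
        have h2 := G.length_lt h1
        refine ih _ ?_ h1 rfl
        simp only [List.length_append, List.length_singleton] at h2 ⊢
        omega
      choose ch hch using hb
      exact ⟨node (G.mover x) ch, h, rfl, hch⟩
    · exact ⟨leaf (G.result x), hx, h, rfl⟩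

/-- The plan `p` and the standard strategy `σ` prescribe the same actions at the information sets
of player `i` in the subgame that starts at `x`. -/
def Agrees : (t : GameTree I Z) → List Bool → (i : I) → t.Strat → G.StdStrategy i → Prop
  | leaf _, _, _, _, _ => True
  | node _ ch, x, i, p, σ => (∀ h : G.Nonterminal x ∧ G.mover x = i, (σ ⟨x, h⟩).1 = p.1) ∧
      ∀ b, Agrees (ch b) (x ++ [b]) i (p.2 b) σ

variable {G}

theorem result_playFrom {t : GameTree I Z} {x : List Bool} (ht : G.Represents t x)
    {p : I → t.Strat} {σ : ∀ i, G.StdStrategy i} (h : ∀ i, G.Agrees t x i (p i) (σ i)) :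
    G.result (G.playFrom σ x) = t.play p := by
  induction t generalizing x with
  | leaf z => rw [G.playFrom_of_terminal ht.2.1]; exact ht.2.2
  | node a ch ih =>
    obtain ⟨hn, rfl, hb⟩ := ht
    rw [← G.playFrom_next hn.1, G.next_of_nonterminal hn, (h _).1 ⟨hn, rfl⟩]
    exact ih _ (hb _) fun i => (h i).2 _

theorem exists_agrees (t : GameTree I Z) (x : List Bool) {i : I} (σ : G.StdStrategy i) :
    ∃ p, G.Agrees t x i p σ := by
  classical
  induction t generalizing x with
  | leaf => exact ⟨(), trivial⟩
  | node a ch ih =>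
    choose p hp using fun b => ih b (x ++ [b])
    obtain ⟨b, hb⟩ : ∃ b, ∀ h : G.Nonterminal x ∧ G.mover x = i, (σ ⟨x, h⟩).1 = b := by
      by_cases h : G.Nonterminal x ∧ G.mover x = i
      · exact ⟨(σ ⟨x, h⟩).1, fun _ => rfl⟩
      · exact ⟨true, fun h' => absurd h' h⟩
    exact ⟨(b, p), hb, hp⟩

theorem Agrees.congr {t : GameTree I Z} {x : List Bool} {i : I} {p : t.Strat}
    {σ σ' : G.StdStrategy i} (h : G.Agrees t x i p σ)
    (hσ : ∀ y : G.InfoSet i, x <+: y.1 → σ y = σ' y) : G.Agrees t x i p σ' := by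
  induction t generalizing x with
  | leaf => trivial
  | node a ch ih =>
    exact ⟨fun hx => (congrArg Subtype.val (hσ ⟨x, hx⟩ List.prefix_rfl)).symm.trans (h.1 hx), fun b => ih b (h.2 b)
      fun y hy => hσ y ((List.prefix_append _ _).trans hy)⟩

/-- The action that a plan prescribes after a sequence of actions. -/
def _root_.GameTree.action : (t : GameTree I Z) → t.Strat → List Bool → Bool
  | leaf _, _, _ => true
  | node _ _, p, [] => p.1
  | node _ ch, p, b :: y => action (ch b) (p.2 b) y

theorem agrees_of_action {t : GameTree I Z} {x : List Bool} {i : I} {p : t.Strat}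
    {σ : G.StdStrategy i}
    (h : ∀ z : G.InfoSet i, ∀ y, z.1 = x ++ y → (σ z).1 = t.action p y) : G.Agrees t x i p σ := by
  induction t generalizing x with
  | leaf => trivial
  | node a ch ih =>
    exact ⟨fun hx => h ⟨x, hx⟩ [] (by simp), fun b => ih b fun z y hz =>
      h z (b :: y) (by simp [hz])⟩

theorem exists_agrees_nil (t : GameTree I Z) (i : I) (p : t.Strat) :
    ∃ σ : G.StdStrategy i, G.Agrees t [] i p σ :=
  ⟨fun z => ⟨t.action p z.1, G.append_mem z.2.1 _⟩, agrees_of_action fun z y hz => by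
    rw [List.nil_append] at hz; rw [← hz]⟩

/-! ### Plans induced by restrictions of the game -/

variable (G) in
/-- The plans of the subgame at `x` induced by the strategies in `R` that allow `x`. -/
def plansAt (R : ∀ j, Set (G.Strategy j)) (t : GameTree I Z) (x : List Bool) :
    I → Set t.Strat :=
  fun i => {p | ∃ σ : G.StdStrategy i, G.toStrategy σ ∈ R i ∧ G.Allows σ x ∧ G.Agrees t x i p σ}

/-- Links conditioning in the game to restriction in the tree: for the mover, allowing the longer
history is the root clause of `restrict`; for the others it adds nothing. -/
theorem restrict_plansAt {R : ∀ j, Set (G.Strategy j)} {a : I} {ch : Bool → GameTree I Z}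
    {x : List Bool} (ht : G.Represents (node a ch) x) (b : Bool) :
    restrict (G.plansAt R (node a ch) x) b = G.plansAt R (ch b) (x ++ [b]) := by
  obtain ⟨hn, rfl, hb⟩ := ht
  funext i
  ext s
  constructor
  · rintro ⟨r, ⟨σ, h1, h2, h3⟩, h4, rfl⟩
    refine ⟨σ, h1, (G.allows_append_iff (G.append_mem hn b) σ).2 ⟨h2, fun h => ?_⟩, h3.2 b⟩
    rw [h3.1 h]
    exact h4 h.2.symm
  · rintro ⟨σ, h1, h2, h3⟩
    obtain ⟨h4, h5⟩ := (G.allows_append_iff (G.append_mem hn b) σ).1 h2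
    obtain ⟨s', hs'⟩ := exists_agrees (ch (!b)) (x ++ [!b]) σ
    obtain ⟨r, hr0, rfl, rfl⟩ := exists_strat (a := G.mover x) (ch := ch) b b s s'
    refine ⟨r, ⟨σ, h1, h4, fun h => by rw [hr0, h5 h], fun b' => ?_⟩, fun _ => hr0, rfl⟩
    rcases Bool.eq_or_eq_not b' b with rfl | rfl
    · exact h3
    · exact hs'

theorem not_prefix_of_terminal {x y : List Bool} (hx : ¬ G.Nonterminal x) (hy : G.Nonterminal y) :
    ¬ x <+: y := by
  rintro ⟨l, rfl⟩
  cases l with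
  | nil => exact hx (by simpa using hy)
  | cons b l =>
    exact hx (G.nonterminal_of_append_mem (a := b) (G.prefix_mem ⟨l, by simp⟩ hy.1))

/-- Justified plans are best replies in the subgames that they reach. -/
theorem exists_noGain_of_justified {R : ∀ j, Set (G.Strategy j)} {t : GameTree I Z}
    {x : List Bool} (ht : G.Represents t x) {i : I} {p : t.Strat} {σ : G.StdStrategy i}
    (hJ : Justified G.pref t (G.plansAt R t x) i p) (hσ : G.Agrees t x i p σ) (h : G.InfoSet i)
    (hx : x <+: h.1) (hh : G.Allows σ h.1)
    (hne : ∀ j, j ≠ i → ∃ s : G.StdStrategy j, G.toStrategy s ∈ R j ∧ G.Allows s h.1) :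
    ∃ τ : ∀ j, G.StdStrategy j, τ i = σ ∧
      (∀ j, j ≠ i → G.toStrategy (τ j) ∈ R j ∧ G.Allows (τ j) h.1) ∧
      ∀ τ' : ∀ j, G.StdStrategy j, (∀ j, j ≠ i → τ' j = τ j) →
        G.pref i (G.result (G.playFrom τ h.1)) (G.result (G.playFrom τ' h.1)) := by
  classical
  induction t generalizing x with
  | leaf z => exact absurd hx (not_prefix_of_terminal ht.2.1 h.2.1)
  | node a ch ih =>
    obtain ⟨z, hn, hi⟩ := h
    by_cases hzx : z = x
    · subst hzx
      dsimp only at hx hh hne ⊢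
      have ha : G.mover z = a := ht.2.1
      obtain ⟨q, h1, h2, h3⟩ := hJ.1 (by rw [← hi, ha]) fun j hj => by
        obtain ⟨s, hs1, hs2⟩ := hne j hj
        obtain ⟨r, hr⟩ := exists_agrees (node a ch) z s
        exact ⟨r, s, hs1, hs2, hr⟩
      have h2' : ∀ j, ∃ s : G.StdStrategy j, j ≠ i → G.toStrategy s ∈ R j ∧ G.Allows s z ∧
          G.Agrees (node a ch) z j (q j) s := fun j => by
        by_cases hj : j = i
        · subst hj; exact ⟨σ, fun h => absurd rfl h⟩
        · obtain ⟨s, hs⟩ := h2 j hj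
          exact ⟨s, fun _ => hs⟩
      choose s hs using h2'
      set τ := Function.update s i σ with hτ
      have hag : ∀ j, G.Agrees (node a ch) z j (q j) (τ j) := fun j => by
        by_cases hj : j = i
        · subst hj; simp only [hτ, Function.update_self, h1]; exact hσ
        · simp only [hτ, Function.update_of_ne hj]; exact (hs j hj).2.2
      refine ⟨τ, by simp [hτ], fun j hj => ?_, fun τ' hτ' => ?_⟩
      · simp only [hτ, Function.update_of_ne hj]; exact ⟨(hs j hj).1, (hs j hj).2.1⟩
      · obtain ⟨p', hp'⟩ := exists_agrees (node a ch) z (τ' i)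
        rw [result_playFrom ht hag, result_playFrom ht (p := Function.update q i p')]
        · exact h3 _ fun j hj => by simp [hj]
        · intro j
          by_cases hj : j = i
          · subst hj; simpa using hp'
          · rw [Function.update_of_ne hj, hτ' j hj]; exact hag j
    · obtain ⟨l, rfl⟩ := hx
      obtain ⟨b, l, rfl⟩ : ∃ b l', l = b :: l' := List.exists_cons_of_ne_nil fun h => hzx (by simp [h])
      have hx' : x ++ [b] <+: x ++ b :: l := ⟨l, by simp⟩
      refine ih b (ht.2.2 b) (p := p.2 b) ?_ (hσ.2 b) hx'
      rw [← restrict_plansAt ht]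
      refine hJ.2 b fun hia => ?_
      have hix : G.Nonterminal x ∧ G.mover x = i := ⟨ht.1, by rw [hia]; exact ht.2.1⟩
      rw [← hσ.1 hix]
      exact (G.allows_iff hn.1 σ).1 hh x b hx' hix

/-- Strategies that are justified at all the information sets that they allow survive. -/
theorem mem_undominated_of_justified {R : ∀ j, Set (G.Strategy j)} {t : GameTree I Z}
    (ht : G.Represents t []) {i : I} {p : t.Strat} {σ : G.StdStrategy i}
    (hR : G.toStrategy σ ∈ R i)
    (hJ : Justified G.pref t (G.plansAt R t []) i p) (hσ : G.Agrees t [] i p σ) :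
    G.toStrategy σ ∈ G.undominated R i := by
  classical
  refine ⟨hR, fun h hreach _ hopp hdom => ?_⟩
  have hh := G.mem_reachOwn_iff.1 hreach
  have hmem := h.2.1.1
  obtain ⟨τ, rfl, h2, h3⟩ := exists_noGain_of_justified ht hJ hσ h List.nil_prefix hh fun j hj => by
    obtain ⟨q, hq1, hq2⟩ := hopp
    exact ⟨(q ⟨j, hj⟩).out, by rw [G.toStrategy_out]; exact hq1 ⟨j, hj⟩,
      G.allows_out_iff.2 ((G.mem_reachOpp_iff hmem).1 hq2 ⟨j, hj⟩)⟩
  have hallow : ∀ j, G.Allows (τ j) h.1 := fun j => by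
    by_cases hj : j = i
    · subst hj; exact hh
    · exact (h2 j hj).2
  set S : ∀ j, G.Strategy j := fun j => G.toStrategy (τ j) with hS
  have hB : ∀ q ∈ Set.univ.pi (fun j : {j : I // j ≠ i} => ({S j.1} : Set (G.Strategy j.1))),
      q = G.opponents i S := fun q hq => funext fun j => hq j trivial
  -- The product set refuting B-dominance is the singleton of the justifying profile, against which
  -- a best reply cannot be weakly dominated.
  refine hdom.2 (fun j => {S j.1}) ⟨G.opponents i S, fun _ _ => rfl⟩ ?_ ⟨⟨hR, hreach⟩, ?_⟩
  · intro q hq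
    obtain rfl := hB q hq
    exact ⟨fun j => (h2 j.1 j.2).1,
      (G.mem_reachOpp_iff hmem).2 fun j => G.mem_reachOwn_iff.2 (h2 j.1 j.2).2⟩
  · rintro ⟨s, ⟨-, hs⟩, -, q, hq, -, hlt⟩
    obtain rfl := hB q hq
    refine hlt ?_
    set τ' := Function.update τ i s.out with hτ'
    have hq' : G.opponents i S = G.opponents i fun j => G.toStrategy (τ' j) :=
      funext fun j => by simp only [opponents, hS, hτ', Function.update_of_ne j.2]
    have hs' : G.toStrategy (τ' i) = s := by rw [hτ', Function.update_self, toStrategy_out]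
    have hallow' : ∀ j, G.Allows (τ' j) h.1 := fun j => by
      by_cases hj : j = i
      · subst hj; rw [hτ', Function.update_self]; exact G.allows_out_iff.2 hs
      · rw [hτ', Function.update_of_ne hj]; exact hallow j
    have e : G.join (G.toStrategy (τ i)) (G.opponents i S) = S := G.join_opponents rfl
    rw [e, hq', G.join_opponents hs', G.outcome_toStrategy hmem hallow,
      G.outcome_toStrategy hmem hallow']
    exact h3 τ' fun j hj => Function.update_of_ne hj _ _

/-- The plans induced by a fixed point of the elimination operator are not strictly dominated. -/
theorem undominated_of_fixed {R : ∀ j, Set (G.Strategy j)} (hR : G.undominated R = R)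
    (hP : LinearPref G.pref)
    {t : GameTree I Z} {x : List Bool} (ht : G.Represents t x) (i : I) (p : t.Strat)
    (hp : p ∈ G.plansAt R t x i) : Undominated G.pref t (G.plansAt R t x) i p := by
  classical
  induction t generalizing x with
  | leaf => trivial
  | node a ch ih =>
    refine ⟨fun hi hne p' hp' => ?_, fun b hb => ?_⟩
    · subst hi
      by_contra! H
      obtain ⟨σ, h1, h2, h3⟩ := hp
      obtain ⟨σ', h1', h2', h3'⟩ := hp'
      have hmem := ht.mem
      have hnd := (hR.symm ▸ h1 : G.toStrategy σ ∈ G.undominated R i).2 ⟨x, ht.1, ht.2.1⟩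
        (G.mem_reachOwn_iff.2 h2) ⟨_, h1, G.mem_reachOwn_iff.2 h2⟩
        ⟨fun j => G.toStrategy (hne j.1 j.2).some_mem.choose,
          fun j => (hne j.1 j.2).some_mem.choose_spec.1, (G.mem_reachOpp_iff hmem).2 fun j =>
          G.mem_reachOwn_iff.2 (hne j.1 j.2).some_mem.choose_spec.2.1⟩
      refine hnd ⟨⟨h1, G.mem_reachOwn_iff.2 h2⟩, fun B hB hsub hadm => hadm.2
        ⟨G.toStrategy σ', ⟨h1', G.mem_reachOwn_iff.2 h2'⟩, ?_⟩⟩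
      -- Failure of the claim makes `σ'` strictly better against every surviving opponents' profile
      -- reaching `x`, hence weakly dominant against every nonempty `B`.
      have key : ∀ q : G.Opp i, q ∈ Set.univ.pi B → G.strictPref i
          (G.outcome (G.join (G.toStrategy σ') q)) (G.outcome (G.join (G.toStrategy σ) q)) := by
        intro q hq
        obtain ⟨hq1, hq2⟩ := hsub hq
        have hq3 := (G.mem_reachOpp_iff hmem).1 hq2
        set τ : (s : G.StdStrategy i) → ∀ j, G.StdStrategy j := fun s =>
          Function.update (fun j => (G.join (G.toStrategy s) q j).out) i s with hτ
        have hτi : ∀ s, τ s i = s := fun s => Function.update_self ..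
        have hτj : ∀ s j (h : j ≠ i), τ s j = (q ⟨j, h⟩).out := fun s j h => by
          simp only [hτ]
          rw [Function.update_of_ne h, G.join_of_ne _ _ h]
        have hq : ∀ s, G.Allows s x →
            G.outcome (G.join (G.toStrategy s) q) = G.result (G.playFrom (τ s) x) := by
          intro s hs
          rw [← G.outcome_toStrategy hmem (σ := τ s) fun j => ?_,
            G.toStrategy_update_out s _ (G.join_self _ _)]
          by_cases hj : j = i
          · subst hj; rw [hτi]; exact hs
          · rw [hτj s j hj]; exact G.allows_out_iff.2 (hq3 ⟨j, hj⟩)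
        choose r hr using fun j => exists_agrees (node i ch) x (τ σ j)
        have e1 : ∀ j, G.Agrees (node i ch) x j (Function.update r i p j) (τ σ j) := fun j => by
          by_cases hj : j = i
          · subst hj; rw [Function.update_self, hτi]; exact h3
          · rw [Function.update_of_ne hj]; exact hr j
        have e2 : ∀ j, G.Agrees (node i ch) x j (Function.update r i p' j) (τ σ' j) := fun j => by
          by_cases hj : j = i
          · subst hj; rw [Function.update_self, hτi]; exact h3'
          · rw [Function.update_of_ne hj, hτj σ' j hj, ← hτj σ j hj]; exact hr j
        rw [hq σ h2, hq σ' h2', result_playFrom ht e1, result_playFrom ht e2]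
        have hnot := H (Function.update r i p) (Function.update r i p') (by simp) (by simp)
          (fun j hj => ⟨τ σ j, by rw [hτj σ j hj, G.toStrategy_out]; exact hq1 ⟨j, hj⟩,
            by rw [hτj σ j hj]; exact G.allows_out_iff.2 (hq3 ⟨j, hj⟩), by
              rw [Function.update_of_ne hj]; exact hr j⟩)
          (fun j hj => by simp [hj])
        exact ⟨(hP.total _ _ _).resolve_left hnot, hnot⟩
      obtain ⟨q, hq⟩ := hB
      exact ⟨fun q hq => (key q hq).1, q, hq, key q hq⟩
    · rw [restrict_plansAt ht]
      refine ih b (ht.2.2 b) _ ?_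
      rw [← restrict_plansAt ht]
      exact ⟨p, hp, hb, rfl⟩

/-! #### Subgame perfect equilibria -/

theorem result_playFrom_of_isSubgamePerfect (hP : LinearPref G.pref)
    {σ : ∀ i, G.StdStrategy i} (hσ : G.IsSubgamePerfect σ) {t : GameTree I Z} {x : List Bool}
    (ht : G.Represents t x) : G.result (G.playFrom σ x) = t.value G.pref := by
  classical
  induction t generalizing x with
  | leaf z => rw [G.playFrom_of_terminal ht.2.1]; exact ht.2.2
  | node a ch ih =>
    obtain ⟨hn, ha, hb⟩ := id ht
    subst ha
    have hd : G.result (G.playFrom σ x) =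
        (ch (σ (G.mover x) ⟨x, hn, rfl⟩).1).value G.pref := by
      rw [← G.playFrom_next hn.1, G.next_of_nonterminal hn]
      exact ih _ (hb _)
    have hle : ∀ b, G.pref (G.mover x) (G.result (G.playFrom σ x)) ((ch b).value G.pref) := by
      intro b
      -- A one-shot deviation at `x`: play below `x` is unchanged, so it yields the value of the
      -- chosen subtree.
      set τ : G.StdStrategy (G.mover x) := fun h =>
        if h.1 = x then ⟨b, G.append_mem h.2.1 b⟩ else σ _ h with hτ
      have hu : Function.update σ (G.mover x) τ (G.mover x) = τ := Function.update_self ..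
      have h1 := hσ x hn.1 (G.mover x) τ
      convert h1 using 1
      rw [← G.playFrom_next hn.1, G.next_of_nonterminal hn]
      have h2 : (Function.update σ (G.mover x) τ (G.mover x) ⟨x, hn, rfl⟩).1 = b := by
        refine (congrArg (fun s : G.StdStrategy _ => (s ⟨x, hn, rfl⟩).1) hu).trans ?_
        exact congrArg Subtype.val (if_pos rfl)
      rw [← ih b (hb b)]
      choose p hp using fun i => exists_agrees (ch b) (x ++ [b]) (σ i)
      rw [h2, result_playFrom (hb b) hp, result_playFrom (hb b) (p := p)]
      intro i
      refine (hp i).congr fun y hy => ?_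
      by_cases hi : i = G.mover x
      · subst hi
        have hne : y.1 ≠ x := fun h => by
          have := hy.length_le; rw [h] at this; simp at this
        refine Eq.trans ?_ (congrArg (fun s : G.StdStrategy _ => s y) hu).symm
        exact (if_neg hne).symm
      · exact (congrArg (fun s : G.StdStrategy i => s y) (Function.update_of_ne hi τ σ)).symm
    obtain ⟨d, h1, -⟩ := value_node hP (G.mover x) ch
    refine hP.antisymm (G.mover x) _ _ (h1 ▸ hle d) ?_
    rw [hd]
    exact pref_value_node hP _ _ _

-- One plan can be given to all players because only the mover's component is used at a node.
-- Optimality is proved against arbitrary deviations at every later history, as subgame perfection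
-- demands.
variable (G) in
theorem exists_plan_optimal (hP : LinearPref G.pref) (t : GameTree I Z) : ∃ p : t.Strat,
    ∀ x, G.Represents t x → ∀ σ : ∀ i, G.StdStrategy i, (∀ i, G.Agrees t x i p (σ i)) →
      t.play (fun _ => p) = t.value G.pref ∧
      ∀ y ∈ G.hist, x <+: y → ∀ i, ∀ τ : ∀ j, G.StdStrategy j, (∀ j, j ≠ i → τ j = σ j) →
        G.pref i (G.result (G.playFrom σ y)) (G.result (G.playFrom τ y)) := by
  induction t with
  | leaf z =>
    refine ⟨(), fun x ht σ _ => ⟨rfl, fun y hy hxy i τ _ => ?_⟩⟩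
    obtain ⟨l, rfl⟩ := hxy
    cases l with
    | nil =>
      rw [List.append_nil, G.playFrom_of_terminal ht.2.1, G.playFrom_of_terminal ht.2.1]
      exact hP.refl _ _
    | cons b l =>
      exact absurd (G.nonterminal_of_append_mem (a := b) (G.prefix_mem ⟨l, by simp⟩ hy)) ht.2.1
  | node a ch ih =>
    choose q hq using ih
    obtain ⟨d, hd, -⟩ := value_node hP a ch
    refine ⟨(d, q), fun x ht σ hσ => ?_⟩
    have hV : GameTree.play (node a ch) (fun _ => ((d, q) : (node a ch).Strat)) =
        value G.pref (node a ch) := by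
      rw [hd, ← (hq d _ (ht.2.2 d) σ fun i => (hσ i).2 d).1]
      rfl
    refine ⟨hV, fun y hy hxy i τ hτ => ?_⟩
    obtain ⟨l, rfl⟩ := hxy
    cases l with
    | nil =>
      rw [List.append_nil, result_playFrom ht hσ, hV]
      obtain ⟨hn, rfl, hb⟩ := ht
      set b := (τ (G.mover x) ⟨x, hn, rfl⟩).1 with hbdef
      have h1 : G.playFrom τ x = G.playFrom τ (x ++ [b]) := by
        rw [← G.playFrom_next hn.1, G.next_of_nonterminal hn]
      have h2 := (hq b _ (hb b) σ fun i => (hσ i).2 b).2 _ (G.append_mem hn b)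
        List.prefix_rfl i τ hτ
      rw [result_playFrom (hb b) fun i => (hσ i).2 b,
        (hq b _ (hb b) σ fun i => (hσ i).2 b).1, ← h1] at h2
      refine hP.trans _ _ _ _ ?_ h2
      by_cases hi : G.mover x = i
      · subst hi; exact pref_value_node hP _ _ _
      · have h3 : b = d := by
          rw [hbdef]
          refine (congrArg (fun s : G.StdStrategy _ => (s ⟨x, hn, rfl⟩).1) (hτ _ hi)).trans ?_
          exact (hσ _).1 ⟨hn, rfl⟩
        rw [hd, h3]
        exact hP.refl _ _
    | cons b l =>
      exact (hq b _ (ht.2.2 b) σ fun i => (hσ i).2 b).2 _ hy ⟨l, by simp⟩ i τ hτ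

/-! ### Conclusion for games with two actions -/

variable (G) in
theorem finite_strategy (i : I) : Finite (G.Strategy i) := by
  have : Finite G.hist := G.hist_finite
  have : Finite (G.InfoSet i) := Finite.of_injective
    (fun h : G.InfoSet i => (⟨h.1, h.2.1.1⟩ : G.hist)) fun h h' e =>
      Subtype.ext (congrArg (fun y : G.hist => y.1) e)
  have : Finite (G.StdStrategy i) :=
    inferInstanceAs (Finite ((h : G.InfoSet i) → {a : Bool // a ∈ G.avail h.1}))
  exact Quotient.finite _

/-- In finite games with perfect information and two actions at every nonterminal history, if no
player is indifferent between two outcomes, then Iterative Conditional B-Dominance yields the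
unique backward induction outcome. -/
theorem exists_outcome_icbd_eq [Finite I] (hP : LinearPref G.pref) :
    ∃ z, G.backwardInductionOutcomes = {z} ∧ G.outcome '' G.icbd = {z} := by
  classical
  obtain ⟨t, ht⟩ := G.exists_represents G.nil_mem
  refine ⟨t.value G.pref, ?_, ?_⟩
  · refine Set.eq_singleton_iff_unique_mem.2 ⟨?_, ?_⟩
    · obtain ⟨p, hp⟩ := G.exists_plan_optimal hP t
      choose σ hσ using fun i => exists_agrees_nil (G := G) t i p
      obtain ⟨h1, h2⟩ := hp [] ht σ hσ
      refine ⟨σ, fun y hy i τ => h2 y hy List.nil_prefix i _ fun j hj =>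
        Function.update_of_ne hj _ _, ?_⟩
      rw [← h1]
      exact result_playFrom ht hσ
    · rintro _ ⟨σ, hσ, rfl⟩
      exact result_playFrom_of_isSubgamePerfect hP hσ ht
  · have hsucc : ∀ n, G.icbdRound (n + 1) = G.undominated (G.icbdRound n) := fun n =>
      Function.iterate_succ_apply' _ _ _
    have hanti : Antitone G.icbdRound := antitone_nat_of_succ_le fun n => by
      rw [hsucc]; exact fun i s hs => hs.1
    set R : ℕ → I → Set t.Strat := fun n => G.plansAt (G.icbdRound n) t [] with hR
    have hRanti : Antitone R := fun m n hmn i p ⟨σ, h1, h2⟩ => ⟨σ, hanti hmn i h1, h2⟩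
    have hsurv : ∀ n i (p : t.Strat) (σ : G.StdStrategy i), G.Agrees t [] i p σ →
        (∀ k < n, Justified G.pref t (R k) i p) → G.toStrategy σ ∈ G.icbdRound n i := by
      intro n
      induction n with
      | zero => exact fun _ _ _ _ _ => trivial
      | succ n ih =>
        intro i p σ hσ hJ
        rw [hsucc]
        exact mem_undominated_of_justified ht (ih i p σ hσ fun k hk => hJ k (by omega))
          (hJ n (by omega)) hσ
    -- Justification in all earlier rounds ensures survival, so the rounds form a chain to which
    -- `KeepsValue` applies, without outside options.
    have hcl : ∀ n i, robust G.pref R (fun _ => none) n i ⊆ R n i := by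
      intro n i p hp
      obtain ⟨σ, hσ⟩ := exists_agrees_nil (G := G) t i p
      exact ⟨σ, hsurv n i p σ hσ (robust_justified hp), G.allows_nil σ, hσ⟩
    have := G.finite_strategy
    -- Finiteness makes the procedure stop at some round `K`: a fixed point that contains the
    -- profile `β` and has only one outcome.
    obtain ⟨K, hK⟩ := exists_forall_eq_of_antitone hanti
    have hfix : G.undominated (G.icbdRound K) = G.icbdRound K := by
      rw [← hsucc]; exact hK _ (Nat.le_succ K)
    obtain ⟨β, hβ, hβV, -⟩ := (keepsValue_and_convergesToValue hP t).1 R (fun _ => none) K hRanti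
      (fun n _ => hcl n) (by simp)
    have hβ' : ∀ i, β i ∈ R K i := fun i => hcl K i (hβ i)
    refine Set.eq_singleton_iff_unique_mem.2 ⟨?_, ?_⟩
    · choose σ h1 h2 h3 using hβ'
      refine ⟨fun i => G.toStrategy (σ i), Set.mem_iInter.2 fun n i _ => ?_, ?_⟩
      · rcases le_total n K with h | h
        · exact hanti h i (h1 i)
        · rw [hK n h]; exact h1 i
      · rw [G.outcome_toStrategy G.nil_mem h2, result_playFrom ht h3, hβV]
    · rintro _ ⟨S, hS, rfl⟩
      have hSK : ∀ i, S i ∈ G.icbdRound K i := fun i => Set.mem_iInter.1 hS K i trivial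
      choose p hp using fun i => exists_agrees (G := G) t [] (S i).out
      have hpR : ∀ i, p i ∈ R K i := fun i =>
        ⟨(S i).out, by rw [G.toStrategy_out]; exact hSK i, G.allows_nil _, hp i⟩
      rw [← hβV, ← play_eq_of_undominated hP (R := R K)
        (fun i p hp => undominated_of_fixed hfix hP ht i p hp) hpR hβ']
      exact result_playFrom ht hp

end Binary
end PIGame

/-- In the perfect-information game induced by a binary agenda with sequential majority voting,
with an odd number of voters and without indifference, the backward induction outcome is unique
and it is the unique outcome of Iterative Conditional B-Dominance. -/
theorem mainTheorem10 {K I : Type*} [Finite K] [Fintype I] [Nonempty I]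
    (hodd : Odd (Fintype.card I))
    (order : Fin (Fintype.card I) ≃ I)
    (Ψ : BinaryAgenda K I) (hΨ : Ψ.NoIndifference) :
    ∃ z : K, (Ψ.votingGame order).backwardInductionOutcomes = {z} ∧
      (Ψ.votingGame order).outcome '' (Ψ.votingGame order).icbd = {z} :=
  PIGame.exists_outcome_icbd_eq ⟨Ψ.pref_total, Ψ.pref_trans, hΨ⟩
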